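/- Fix an integer $d\ge 2$. For a set $\mathcal B$ of $n$ boxes (axis-aligned closed hyper-rectangles with non-empty interior) in $\mathbb R^d$, consider the grid formed by the hyperplanes that extend the facets of the boxes of $\mathcal B$, and let the coverage discretization $\mathcal D(\mathcal B)$ be the set of the middle points of those cells of the grid that lie completely inside some box of $\mathcal B$. A weight index for $\mathcal D(\mathcal B)$ is a data structure that maintains a weight for every point of $\mathcal D(\mathcal B)$ and supports the following operations: - Initialization: given $\mathcal B$ (as an unsorted list of boxes), assign the weight $1$ to every point of $\mathcal D(\mathcal B)$; - Query: given a box $b\in\mathcal B$, return the total weight of the points of $\mathcal D(\mathcal B)$ in $b$; - Update: given a box $b\in\mathcal B$ and a real number $\alpha\ge 0$, multiply by $\alpha$ the weights of all points of $\mathcal D(\mathcal B)$ in $b$. Each arithmetic operation on, or comparison of, two real numbers takes constant time. Then there is a weight index for $\mathcal D(\mathcal B)$ (one data structure for every set $\mathcal B$ of boxes in $\mathbb R^d$) whose initialization runs in time $O\bigl(n^{\frac{d+1}{2}}\bigr)$ and whose queries and updates each run in worst-case time $O\bigl(n^{\frac{d-1}{2}}\log n\bigr)$, after any finite sequence of earlier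 operations. The bounds are for $n\to\infty$, with constants that depend only on $d$. -/

import Mathlib

open BoxIntegral Asymptotics Filter

/-! ### The coverage discretization -/

namespace CoverageKernel

/-- The `i`-th coordinates of the grid hyperplanes: the grid of a family of boxes consists of the
hyperplanes that extend the facets of the boxes. -/
def gridCoords {d : ℕ} (B : List (Box (Fin d))) (i : Fin d) : Set ℝ :=
  {x | ∃ b ∈ B, x = b.lower i ∨ x = b.upper i}

/-- The bounded cells of the grid: in every direction the cell extends between two
consecutive grid coordinates. (Unbounded cells lie in no box.) -/
def IsGridCell {d : ℕ} (B : List (Box (Fin d))) (c : Box (Fin d)) : Prop :=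
  ∀ i, c.lower i ∈ gridCoords B i ∧ c.upper i ∈ gridCoords B i ∧
    ∀ x ∈ gridCoords B i, x ≤ c.lower i ∨ c.upper i ≤ x

/-- The middle point of a box. -/
noncomputable def center {d : ℕ} (c : Box (Fin d)) : Fin d → ℝ :=
  fun i => (c.lower i + c.upper i) / 2

/-- The middle points of those grid cells that lie completely inside some (closed) box. -/
def discretizationSet {d : ℕ} (B : List (Box (Fin d))) : Set (Fin d → ℝ) :=
  {p | ∃ c : Box (Fin d), IsGridCell B c ∧ (∃ b ∈ B, Box.Icc c ⊆ Box.Icc b) ∧ p = center c}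

theorem gridCoords_finite {d : ℕ} (B : List (Box (Fin d))) (i : Fin d) :
    (gridCoords B i).Finite := by
  have h : gridCoords B i ⊆
      ((fun b : Box (Fin d) => b.lower i) '' {b | b ∈ B}) ∪
      ((fun b : Box (Fin d) => b.upper i) '' {b | b ∈ B}) := by
    rintro x ⟨b, hb, rfl | rfl⟩
    · exact Or.inl ⟨b, hb, rfl⟩
    · exact Or.inr ⟨b, hb, rfl⟩
  have hB : {b | b ∈ B}.Finite := List.finite_toSet B
  exact ((hB.image _).union (hB.image _)).subset h

theorem discretizationSet_finite {d : ℕ} (B : List (Box (Fin d))) :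
    (discretizationSet B).Finite := by
  have hG : (Set.univ.pi fun i => gridCoords B i).Finite :=
    Set.Finite.pi fun i => gridCoords_finite B i
  refine ((hG.prod hG).image
    (fun q : (Fin d → ℝ) × (Fin d → ℝ) => fun i => (q.1 i + q.2 i) / 2)).subset ?_
  rintro p ⟨c, hc, -, rfl⟩
  exact ⟨(c.lower, c.upper), ⟨fun i _ => (hc i).1, fun i _ => (hc i).2.1⟩, rfl⟩

/-- The coverage discretization of the boxes in `B`. -/
noncomputable def discretization {d : ℕ} (B : List (Box (Fin d))) : Finset (Fin d → ℝ) :=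
  (discretizationSet_finite B).toFinset

open scoped Classical in
/-- The total weight of the points of the discretization of `B` in the closed box `b`. -/
noncomputable def totalWeight {d : ℕ} (B : List (Box (Fin d))) (w : (Fin d → ℝ) → ℝ)
    (b : Box (Fin d)) : ℝ :=
  ∑ p ∈ discretization B with p ∈ Box.Icc b, w p

open scoped Classical in
/-- Multiply by `α` the weights of the points in the closed box `b`. -/
noncomputable def scaleWeights {d : ℕ} (w : (Fin d → ℝ) → ℝ) (b : Box (Fin d)) (α : ℝ) :
    (Fin d → ℝ) → ℝ :=
  fun p => if p ∈ Box.Icc b then α * w p else w p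

/-! ### The machine model

Programs are finite systems of mutually recursive functions over linked structures: memory
consists of immutable cells that hold either a real number or two pointers. Every elementary step
(reading a variable, allocating or inspecting a cell, adding, subtracting, multiplying or comparing
two real numbers, calling a function) costs one unit. There is no rounding, no integer division and
no address arithmetic. Since a program is a fixed finite object, each step takes constant
time on a real RAM. -/

/-- Linked structures with real numbers at the leaves. -/
inductive Val : Type
  | nil : Val
  | num (x : ℝ) : Val
  | cons (a b : Val) : Val

/-- Expressions. Variables are numbered from the innermost binding outwards. -/
inductive Exp : Type
  /-- the value of a variable -/
  | var (i : ℕ) : Exp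
  /-- the empty structure -/
  | nil : Exp
  /-- an integer constant -/
  | const (k : ℤ) : Exp
  /-- allocate a cell with two pointers -/
  | cons (e₁ e₂ : Exp) : Exp
  /-- if `e` is a cell with two pointers, bind both and evaluate `e₁`, otherwise evaluate `e₂` -/
  | casePair (e e₁ e₂ : Exp) : Exp
  | add (e₁ e₂ : Exp) : Exp
  | sub (e₁ e₂ : Exp) : Exp
  | mul (e₁ e₂ : Exp) : Exp
  /-- if `e₁ ≤ e₂` then `e₃` else `e₄` -/
  | ifLe (e₁ e₂ e₃ e₄ : Exp) : Exp
  /-- bind the value of `e₁` and evaluate `e₂` -/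
  | letIn (e₁ e₂ : Exp) : Exp
  /-- apply the function number `f` of the program -/
  | call (f : ℕ) (e : Exp) : Exp

/-- A program: the list of the bodies of its functions, each with its argument as variable `0`. -/
abbrev Program : Type := List Exp

/-- `Eval P env e v t`: in the environment `env`, the evaluation of `e` terminates with the value
`v` after exactly `t` steps. -/
inductive Eval (P : Program) : List Val → Exp → Val → ℕ → Prop
  | var {env : List Val} {i : ℕ} {v : Val} (h : env[i]? = some v) : Eval P env (.var i) v 1
  | nil {env : List Val} : Eval P env .nil .nil 1
  | const {env : List Val} {k : ℤ} : Eval P env (.const k) (.num (k : ℝ)) 1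
  | cons {env : List Val} {e₁ e₂ : Exp} {v₁ v₂ : Val} {t₁ t₂ : ℕ}
      (h₁ : Eval P env e₁ v₁ t₁) (h₂ : Eval P env e₂ v₂ t₂) :
      Eval P env (.cons e₁ e₂) (.cons v₁ v₂) (t₁ + t₂ + 1)
  | casePair_cons {env : List Val} {e e₁ e₂ : Exp} {a b v : Val} {t t₁ : ℕ}
      (h : Eval P env e (.cons a b) t) (h₁ : Eval P (a :: b :: env) e₁ v t₁) :
      Eval P env (.casePair e e₁ e₂) v (t + t₁ + 1)
  | casePair_nil {env : List Val} {e e₁ e₂ : Exp} {v : Val} {t t₂ : ℕ}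
      (h : Eval P env e .nil t) (h₂ : Eval P env e₂ v t₂) :
      Eval P env (.casePair e e₁ e₂) v (t + t₂ + 1)
  | casePair_num {env : List Val} {e e₁ e₂ : Exp} {x : ℝ} {v : Val} {t t₂ : ℕ}
      (h : Eval P env e (.num x) t) (h₂ : Eval P env e₂ v t₂) :
      Eval P env (.casePair e e₁ e₂) v (t + t₂ + 1)
  | add {env : List Val} {e₁ e₂ : Exp} {x y : ℝ} {t₁ t₂ : ℕ}
      (h₁ : Eval P env e₁ (.num x) t₁) (h₂ : Eval P env e₂ (.num y) t₂) :
      Eval P env (.add e₁ e₂) (.num (x + y)) (t₁ + t₂ + 1)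
  | sub {env : List Val} {e₁ e₂ : Exp} {x y : ℝ} {t₁ t₂ : ℕ}
      (h₁ : Eval P env e₁ (.num x) t₁) (h₂ : Eval P env e₂ (.num y) t₂) :
      Eval P env (.sub e₁ e₂) (.num (x - y)) (t₁ + t₂ + 1)
  | mul {env : List Val} {e₁ e₂ : Exp} {x y : ℝ} {t₁ t₂ : ℕ}
      (h₁ : Eval P env e₁ (.num x) t₁) (h₂ : Eval P env e₂ (.num y) t₂) :
      Eval P env (.mul e₁ e₂) (.num (x * y)) (t₁ + t₂ + 1)
  | ifLe_true {env : List Val} {e₁ e₂ e₃ e₄ : Exp} {x y : ℝ} {v : Val} {t₁ t₂ t₃ : ℕ}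
      (h₁ : Eval P env e₁ (.num x) t₁) (h₂ : Eval P env e₂ (.num y) t₂) (hxy : x ≤ y)
      (h₃ : Eval P env e₃ v t₃) :
      Eval P env (.ifLe e₁ e₂ e₃ e₄) v (t₁ + t₂ + t₃ + 1)
  | ifLe_false {env : List Val} {e₁ e₂ e₃ e₄ : Exp} {x y : ℝ} {v : Val} {t₁ t₂ t₄ : ℕ}
      (h₁ : Eval P env e₁ (.num x) t₁) (h₂ : Eval P env e₂ (.num y) t₂) (hxy : ¬ x ≤ y)
      (h₄ : Eval P env e₄ v t₄) :
      Eval P env (.ifLe e₁ e₂ e₃ e₄) v (t₁ + t₂ + t₄ + 1)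
  | letIn {env : List Val} {e₁ e₂ : Exp} {v₁ v : Val} {t₁ t₂ : ℕ}
      (h₁ : Eval P env e₁ v₁ t₁) (h₂ : Eval P (v₁ :: env) e₂ v t₂) :
      Eval P env (.letIn e₁ e₂) v (t₁ + t₂ + 1)
  | call {env : List Val} {f : ℕ} {e body : Exp} {v₁ v : Val} {t₁ t₂ : ℕ}
      (hf : P[f]? = some body) (h₁ : Eval P env e v₁ t₁) (h₂ : Eval P [v₁] body v t₂) :
      Eval P env (.call f e) v (t₁ + t₂ + 1)

/-- Evaluation is deterministic, so that a run has one result and one running time. -/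
theorem Eval.deterministic {P : Program} {env : List Val} {e : Exp} {v v' : Val} {t t' : ℕ}
    (h : Eval P env e v t) (h' : Eval P env e v' t') : v = v' ∧ t = t' := by
  induction h generalizing v' t' <;> cases h' <;> grind

/-- `Runs P f a r t`: the function number `f` of `P`, applied to `a`, terminates with the result
`r` after exactly `t` steps. -/
def Runs (P : Program) (f : ℕ) (a r : Val) (t : ℕ) : Prop :=
  Eval P [a] (.call f (.var 0)) r t

/-! ### Weight indexes -/

/-- Linked lists. -/
def encodeList (l : List Val) : Val := l.foldr .cons .nil

/-- A box is given as the linked list of its pairs (lower end, upper end), one per dimension. -/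
def encodeBox {d : ℕ} (b : Box (Fin d)) : Val :=
  encodeList (List.ofFn fun i => .cons (.num (b.lower i)) (.num (b.upper i)))

/-- A family of boxes is given as the linked list of its members, in the given order. -/
def encodeBoxes {d : ℕ} (B : List (Box (Fin d))) : Val :=
  encodeList (B.map encodeBox)

/-- A data structure: a program, and the numbers of the functions for its operations. -/
structure DataStructure where
  program : Program
  initFun : ℕ
  queryFun : ℕ
  updateFun : ℕ

/-- `Reaches S B s w`: some finite sequence of updates by factors `α ≥ 0` over boxes of `B`,
performed after the initialization on `B`, takes the data structure into the state `s` and the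
weights of the points from `1` to `w`. -/
inductive Reaches (S : DataStructure) {d : ℕ} (B : List (Box (Fin d))) :
    Val → ((Fin d → ℝ) → ℝ) → Prop
  | start {s : Val} {t : ℕ} (h : Runs S.program S.initFun (encodeBoxes B) s t) :
      Reaches S B s (fun _ => 1)
  | update {s s' : Val} {w : (Fin d → ℝ) → ℝ} {b : Box (Fin d)} {α : ℝ} {t : ℕ}
      (hs : Reaches S B s w) (hb : b ∈ B) (hα : 0 ≤ α)
      (h : Runs S.program S.updateFun (.cons s (.cons (encodeBox b) (.num α))) s' t) :
      Reaches S B s' (scaleWeights w b α)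

/-- `S` is a weight index for the discretization of `B`: the initialization takes at most `tInit`
steps and, after any sequence of updates, every query for the total weight in a box of `B` is
answered correctly within `tQuery` steps, and every update takes at most `tUpdate` steps. -/
structure IsWeightIndex (S : DataStructure) {d : ℕ} (B : List (Box (Fin d)))
    (tInit tQuery tUpdate : ℕ) : Prop where
  init_runs : ∃ s t, Runs S.program S.initFun (encodeBoxes B) s t ∧ t ≤ tInit
  query_runs : ∀ s w, Reaches S B s w → ∀ b ∈ B,
    ∃ t, Runs S.program S.queryFun (.cons s (encodeBox b)) (.num (totalWeight B w b)) t ∧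
      t ≤ tQuery
  update_runs : ∀ s w, Reaches S B s w → ∀ b ∈ B, ∀ α : ℝ, 0 ≤ α →
    ∃ s' t, Runs S.program S.updateFun (.cons s (.cons (encodeBox b) (.num α))) s' t ∧
      t ≤ tUpdate

end CoverageKernel

namespace CoverageKernel

/-! ### The program -/

/-! The numbers of the functions. -/

/-! The weights form a discrete measure, stored as a tree that combines sums and products (`WTree`).
All grid cells enter the tree, covered or not, with initial weight 1: inside a box of the family
every grid cell is covered (`mem_discretization_iff`), so queries do not see the difference.

Space is partitioned in the manner of Overmars and Yap. Put M = ⌊√n⌋ + 1 and treat the dimensions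
from the last to the first. A region that is already bounded in the last e dimensions is cut in the
next one into chunks of at most M elementary intervals, with additional cuts at each end of a box
whose later sides meet the region partially. Two invariants result (`IsPartialTree.times`). At most
eM boxes meet the region partially, because a chunk has at most M ends in its interior; hence every
division has at most K = O(√n) chunks (`mul_length_chunks_le`). Moreover, no box cuts a finished
region in more than one dimension. Relative to such a region a box is disjoint, containing, or a
slab, and scaling a slab preserves the product form of the weights. So a finished region is a
product of one-dimensional balanced trees, and an update changes a single factor. Pending
multipliers at the inner nodes make updates lazy. Correctness is expressed by integrals:
`query_eq_integral` and `integral_update`.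

A node is expanded only if an end of the given box lies strictly inside the corresponding side of
the node, so it suffices to count the nodes crossed by a hyperplane (`visits_le`). In the dimension
that it is orthogonal to, the hyperplane follows one path of the balanced tree over the chunks; in
the other d - 1 dimensions it may enter all K chunks; in each region reached it crosses O(log n)
nodes. This gives O(K ^ (d - 1) log n) visited nodes (`exists_build`). The ends are sorted once per
dimension. Afterwards each of the O(K ^ (d - 1)) unfinished regions is divided in time O(n), which
sums to O(n ^ ((d + 1) / 2)) (`isBigO_buildTime`).

Running times are derived by symbolic execution: `wp` turns a function body into a proof obligation
on its value and on an upper bound for its number of steps. -/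

abbrev relFn : ℕ := 0
abbrev clsFn : ℕ := 1
abbrev hullFn : ℕ := 2
abbrev pairFn : ℕ := 3
abbrev loopFn : ℕ := 4
abbrev wrapFn : ℕ := 5
abbrev mergeFn : ℕ := 6
abbrev msortFn : ℕ := 7
abbrev joinFn : ℕ := 8
abbrev foldFn : ℕ := 9
abbrev entriesFn : ℕ := 10
abbrev tailsFn : ℕ := 11
abbrev sortDimsFn : ℕ := 12
abbrev lenFn : ℕ := 13
abbrev rootFn : ℕ := 14
abbrev cellFn : ℕ := 15
abbrev cutFn : ℕ := 16
abbrev chunkFn : ℕ := 17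
abbrev timesFn : ℕ := 18
abbrev buildFn : ℕ := 19
abbrev childrenFn : ℕ := 20
abbrev queryFn : ℕ := 21
abbrev updateSplitFn : ℕ := 22
abbrev updateLeftFn : ℕ := 23
abbrev updateRightFn : ℕ := 24
abbrev updateProdFn : ℕ := 25
abbrev updateRootFn : ℕ := 26
abbrev updateFn : ℕ := 27
abbrev setupFn : ℕ := 28

/-! The bodies of the functions. A function of several arguments takes them as nested pairs. -/

def relBody : Exp :=
  .casePair (.var 0) (.casePair (.var 0) (.casePair (.var 3) (.ifLe (.var 1) (.var 2)
  (.const 0) (.ifLe (.var 3) (.var 0) (.const 0) (.ifLe (.var 2) (.var 0) (.ifLe (.var 1)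
  (.var 3) (.const 1) (.const 2)) (.const 2)))) .nil) .nil) .nil

def clsBody : Exp :=
  .casePair (.var 0) (.casePair (.var 0) (.casePair (.var 3) (.mul (.call relFn (.cons (.var
  2) (.var 0))) (.call clsFn (.cons (.var 3) (.var 1)))) (.const 1)) (.const 1)) .nil

def hullBody : Exp :=
  .casePair (.var 0) (.casePair (.var 0) (.casePair (.var 3) (.casePair (.var 2) (.casePair
  (.var 2) (.cons (.cons (.var 2) (.var 1)) (.call hullFn (.cons (.var 7) (.var 5)))) .nil)
  .nil) .nil) .nil) .nil

def pairBody : Exp :=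
  .casePair (.var 0) (.casePair (.var 1) (.cons (.cons (.var 2) (.var 0)) (.call pairFn
  (.var 1))) (.var 2)) (.var 0)

def loopBody : Exp :=
  .casePair (.var 0) (.casePair (.var 1) (.call loopFn (.call pairFn (.var 4))) (.var 0))
  .nil

def wrapBody : Exp :=
  .casePair (.var 0) (.cons (.cons .nil (.var 0)) (.call wrapFn (.var 1))) .nil

def mergeBody : Exp :=
  .casePair (.var 0) (.casePair (.var 0) (.casePair (.var 3) (.casePair (.var 2) (.casePair
  (.var 2) (.ifLe (.var 2) (.var 0) (.cons (.var 6) (.call mergeFn (.cons (.var 7) (.var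
  9)))) (.cons (.var 4) (.call mergeFn (.cons (.var 8) (.var 5))))) .nil) .nil) (.var 2))
  (.var 1)) .nil

def msortBody : Exp :=
  .casePair (.var 0) (.casePair (.var 0) (.call mergeFn (.cons (.call msortFn (.var 2))
  (.call msortFn (.var 3)))) (.cons (.var 1) .nil)) .nil

def joinBody : Exp :=
  .casePair (.var 0) (.casePair (.var 0) (.casePair (.var 1) (.casePair (.var 5) (.casePair
  (.var 1) (.cons (.call hullFn (.cons (.var 6) (.var 2))) (.cons (.add (.var 4) (.var 0))
  (.cons (.const 1) (.cons .nil (.cons (.var 8) (.var 9)))))) .nil) .nil) .nil) .nil) .nil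

def foldBody : Exp :=
  .casePair (.var 0) (.casePair (.var 0) (.call joinFn (.cons (.call foldFn (.var 2)) (.call
  foldFn (.var 3)))) (.var 1)) .nil

def entriesBody : Exp :=
  .casePair (.var 0) (.casePair (.var 0) (.casePair (.var 0) (.cons (.cons (.var 0) (.var
  3)) (.cons (.cons (.var 1) (.var 3)) (.call entriesFn (.var 5)))) .nil) .nil) .nil

def tailsBody : Exp :=
  .casePair (.var 0) (.casePair (.var 0) (.cons (.var 1) (.call tailsFn (.var 3))) .nil)
  .nil

def sortDimsBody : Exp :=
  .casePair (.var 0) (.casePair (.var 0) (.casePair (.var 0) (.call sortDimsFn (.cons (.call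
  tailsFn (.var 4)) (.cons (.call msortFn (.call loopFn (.call wrapFn (.call entriesFn (.var
  4))))) (.var 5)))) (.var 3)) (.var 1)) .nil

def lenBody : Exp :=
  .casePair (.var 0) (.add (.const 1) (.call lenFn (.var 1))) (.const 0)

def rootBody : Exp :=
  .casePair (.var 0) (.ifLe (.mul (.var 0) (.var 0)) (.var 1) (.call rootFn (.cons (.add
  (.var 0) (.const 1)) (.var 1))) (.var 0)) .nil

def cellBody : Exp :=
  .casePair (.var 0) (.cons (.cons (.cons (.var 0) (.var 1)) .nil) (.cons (.ifLe (.var 1)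
  (.var 0) (.const 0) (.const 1)) .nil)) .nil

def cutBody : Exp :=
  .casePair (.var 0) (.casePair (.var 1) (.casePair (.var 1) (.ifLe (.var 1) (.add (.var 0)
  (.const 1)) (.const 1) (.ifLe (.const 2) (.call clsFn (.cons (.var 4) (.var 2))) (.const
  1) (.const 0))) .nil) .nil) .nil

def chunkBody : Exp :=
  .casePair (.var 0) (.casePair (.var 1) (.casePair (.var 1) (.casePair (.var 1) (.casePair
  (.var 4) (.casePair (.var 0) (.ifLe (.const 1) (.call cutFn (.cons (.var 1) (.cons (.var
  4) (.cons (.var 6) (.var 5))))) (.cons (.cons (.call cellFn (.cons (.var 10) (.var 0)))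
  .nil) (.call chunkFn (.cons (.var 0) (.cons (.var 3) (.cons (.const 0) (.cons (.var 4)
  (.var 5))))))) (.casePair (.call chunkFn (.cons (.var 0) (.cons (.var 3) (.cons (.add
  (.var 6) (.const 1)) (.cons (.var 4) (.var 5)))))) (.cons (.cons (.call cellFn (.cons
  (.var 12) (.var 2))) (.var 0)) (.var 1)) (.cons (.cons (.call cellFn (.cons (.var 10)
  (.var 0))) .nil) .nil))) .nil) .nil) .nil) .nil) .nil) .nil

def timesBody : Exp :=
  .casePair (.var 0) (.casePair (.var 0) (.casePair (.var 1) (.casePair (.var 5) (.casePair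
  (.var 1) (.cons (.casePair (.var 6) (.cons (.var 0) (.var 4)) (.var 2)) (.cons (.mul (.var
  4) (.var 0)) (.cons (.const 1) (.cons (.cons .nil .nil) (.cons (.var 8) (.var 9))))))
  .nil) .nil) .nil) .nil) .nil

def buildBody : Exp :=
  .casePair (.var 0) (.casePair (.var 1) (.casePair (.var 0) (.casePair (.var 0) (.casePair
  (.var 0) (.casePair (.var 8) (.call foldFn (.call loopFn (.call wrapFn (.call childrenFn
  (.cons (.call chunkFn (.cons (.var 2) (.cons (.var 5) (.cons (.const 0) (.cons (.var 0)
  (.var 9)))))) (.cons (.var 10) (.cons (.var 7) (.var 9)))))))) .nil) .nil) .nil) (.var 2))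
  .nil) .nil

def childrenBody : Exp :=
  .casePair (.var 0) (.casePair (.var 1) (.casePair (.var 1) (.casePair (.var 4) (.cons
  (.call buildFn (.cons (.call timesFn (.cons (.call foldFn (.call loopFn (.call wrapFn
  (.var 0)))) (.var 4))) (.cons (.var 2) (.var 3)))) (.call childrenFn (.cons (.var 1)
  (.cons (.var 4) (.cons (.var 2) (.var 3)))))) .nil) .nil) .nil) .nil

def queryBody : Exp :=
  .casePair (.var 0) (.casePair (.var 0) (.casePair (.var 1) (.letIn (.call clsFn (.cons
  (.var 5) (.var 2))) (.ifLe (.var 0) (.const 0) (.const 0) (.ifLe (.var 0) (.const 1) (.var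
  1) (.casePair (.var 2) (.casePair (.var 1) (.casePair (.var 1) (.casePair (.var 2)
  (.casePair (.var 14) (.mul (.var 8) (.mul (.call queryFn (.cons (.var 4) (.cons (.var 0)
  .nil))) (.call queryFn (.cons (.var 5) (.var 1))))) .nil) (.mul (.var 4) (.add (.call
  queryFn (.cons (.var 0) (.var 12))) (.call queryFn (.cons (.var 1) (.var 12)))))) .nil)
  .nil) (.const 0))))) .nil) .nil) .nil

def updateSplitBody : Exp :=
  .casePair (.var 0) (.casePair (.var 1) (.casePair (.var 1) (.casePair (.var 1) (.casePair
  (.var 1) (.casePair (.call updateFn (.cons (.var 4) (.cons (.var 0) (.var 1)))) (.casePair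
  (.var 1) (.casePair (.call updateFn (.cons (.var 6) (.cons (.var 4) (.var 5)))) (.casePair
  (.var 1) (.cons (.var 16) (.cons (.mul (.var 14) (.add (.var 4) (.var 0))) (.cons (.var
  14) (.cons .nil (.cons (.cons (.var 6) (.cons (.var 4) (.var 5))) (.cons (.var 2) (.cons
  (.var 0) (.var 1)))))))) .nil) .nil) .nil) .nil) .nil) .nil) .nil) .nil) .nil

def updateLeftBody : Exp :=
  .casePair (.var 0) (.casePair (.var 1) (.casePair (.var 1) (.casePair (.var 1) (.casePair
  (.var 1) (.casePair (.call updateFn (.cons (.var 4) (.cons (.var 0) (.var 1)))) (.casePair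
  (.var 1) (.casePair (.var 6) (.casePair (.var 1) (.cons (.var 16) (.cons (.mul (.var 14)
  (.mul (.var 4) (.var 0))) (.cons (.var 14) (.cons (.cons .nil .nil) (.cons (.cons (.var 6)
  (.cons (.var 4) (.var 5))) (.var 10)))))) .nil) .nil) .nil) .nil) .nil) .nil) .nil) .nil)
  .nil

def updateRightBody : Exp :=
  .casePair (.var 0) (.casePair (.var 1) (.casePair (.var 1) (.casePair (.var 1) (.casePair
  (.var 1) (.casePair (.var 4) (.casePair (.var 1) (.casePair (.call updateFn (.cons (.var
  6) (.cons (.var 4) (.var 5)))) (.casePair (.var 1) (.cons (.var 16) (.cons (.mul (.var 14)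
  (.mul (.var 4) (.var 0))) (.cons (.var 14) (.cons (.cons .nil .nil) (.cons (.var 12)
  (.cons (.var 2) (.cons (.var 0) (.var 1)))))))) .nil) .nil) .nil) .nil) .nil) .nil) .nil)
  .nil) .nil

def updateProdBody : Exp :=
  .casePair (.var 0) (.casePair (.var 1) (.casePair (.var 1) (.casePair (.var 1) (.casePair
  (.var 1) (.casePair (.var 0) (.casePair (.var 6) (.ifLe (.call clsFn (.cons (.cons (.var
  2) .nil) (.var 0))) (.const 1) (.call updateRightFn (.cons (.var 12) (.cons (.var 10)
  (.cons (.var 8) (.cons (.var 6) (.cons (.var 3) (.var 5))))))) (.call updateLeftFn (.cons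
  (.var 12) (.cons (.var 10) (.cons (.var 8) (.cons (.var 6) (.cons (.cons (.var 2) .nil)
  (.var 5)))))))) .nil) .nil) .nil) .nil) .nil) .nil) .nil

def updateRootBody : Exp :=
  .casePair (.var 0) (.casePair (.var 1) (.casePair (.var 1) (.cons (.var 4) (.cons (.mul
  (.var 2) (.var 1)) (.casePair (.var 0) (.cons (.mul (.var 0) (.var 3)) (.var 1)) .nil)))
  .nil) .nil) .nil

def updateBody : Exp :=
  .casePair (.var 0) (.casePair (.var 1) (.casePair (.var 2) (.casePair (.var 1) (.letIn
  (.call clsFn (.cons (.var 4) (.var 2))) (.ifLe (.var 0) (.const 0) (.var 7) (.ifLe (.var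
  0) (.const 1) (.call updateRootFn (.cons (.var 3) (.cons (.var 1) (.cons (.var 2) (.var
  6))))) (.casePair (.var 2) (.casePair (.var 1) (.casePair (.var 1) (.casePair (.var 2)
  (.call updateProdFn (.cons (.var 11) (.cons (.var 6) (.cons (.var 2) (.cons (.var 3)
  (.cons (.var 13) (.var 14))))))) (.call updateSplitFn (.cons (.var 9) (.cons (.var 4)
  (.cons (.var 0) (.cons (.var 1) (.cons (.var 11) (.var 12)))))))) .nil) .nil) (.var 7)))))
  .nil) .nil) .nil) .nil

def setupBody : Exp :=
  .casePair (.var 0) (.call buildFn (.cons (.cons .nil (.cons (.const 1) .nil)) (.cons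
  (.call sortDimsFn (.cons (.var 2) .nil)) (.call rootFn (.cons (.const 0) (.call lenFn
  (.var 2))))))) .nil

def indexProgram : Program :=
  [relBody, clsBody, hullBody, pairBody, loopBody, wrapBody, mergeBody, msortBody, joinBody,
  foldBody, entriesBody, tailsBody, sortDimsBody, lenBody, rootBody, cellBody, cutBody,
  chunkBody, timesBody, buildBody, childrenBody, queryBody, updateSplitBody, updateLeftBody,
  updateRightBody, updateProdBody, updateRootBody, updateBody, setupBody]

/-! ### Symbolic execution -/

/-- The function number `f` of the program maps `a` to `r` within `T` steps. -/
def Calls (f : ℕ) (a r : Val) (T : ℕ) : Prop :=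
  ∃ body t, indexProgram[f]? = some body ∧ Eval indexProgram [a] body r t ∧ t ≤ T

def Val.onNum : Val → (ℝ → Prop) → Prop
  | .num x, k => k x
  | _, _ => False

def Val.onPair : Val → (Val → Val → Prop) → Prop → Prop
  | .cons a b, k, _ => k a b
  | _, _, k => k

/-- A precondition under which `e` evaluates to a value and a time bound that satisfy `Q`. -/
noncomputable def wp : Exp → List Val → (Val → ℕ → Prop) → Prop
  | .var i, env, Q => ∃ v, env[i]? = some v ∧ Q v 1
  | .nil, _, Q => Q .nil 1
  | .const k, _, Q => Q (.num k) 1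
  | .cons e₁ e₂, env, Q =>
      wp e₁ env fun v₁ t₁ => wp e₂ env fun v₂ t₂ => Q (.cons v₁ v₂) (t₁ + t₂ + 1)
  | .casePair e e₁ e₂, env, Q => wp e env fun v t =>
      v.onPair (fun a b => wp e₁ (a :: b :: env) fun w t₁ => Q w (t + t₁ + 1))
        (wp e₂ env fun w t₁ => Q w (t + t₁ + 1))
  | .add e₁ e₂, env, Q => wp e₁ env fun v₁ t₁ => wp e₂ env fun v₂ t₂ =>
      v₁.onNum fun x => v₂.onNum fun y => Q (.num (x + y)) (t₁ + t₂ + 1)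
  | .sub e₁ e₂, env, Q => wp e₁ env fun v₁ t₁ => wp e₂ env fun v₂ t₂ =>
      v₁.onNum fun x => v₂.onNum fun y => Q (.num (x - y)) (t₁ + t₂ + 1)
  | .mul e₁ e₂, env, Q => wp e₁ env fun v₁ t₁ => wp e₂ env fun v₂ t₂ =>
      v₁.onNum fun x => v₂.onNum fun y => Q (.num (x * y)) (t₁ + t₂ + 1)
  | .ifLe e₁ e₂ e₃ e₄, env, Q => wp e₁ env fun v₁ t₁ => wp e₂ env fun v₂ t₂ =>
      v₁.onNum fun x => v₂.onNum fun y =>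
        (x ≤ y → wp e₃ env fun v t => Q v (t₁ + t₂ + t + 1)) ∧
        (¬ x ≤ y → wp e₄ env fun v t => Q v (t₁ + t₂ + t + 1))
  | .letIn e₁ e₂, env, Q => wp e₁ env fun v₁ t₁ =>
      wp e₂ (v₁ :: env) fun v t => Q v (t₁ + t + 1)
  | .call f e, env, Q => wp e env fun v t =>
      ∃ r T, Calls f v r T ∧ Q r (t + T + 1)

/-- Soundness of `wp`. The postcondition speaks of a bound instead of the exact number of steps,
because a call enters through `Calls`, which only gives an upper bound; step counts are sums, so
bounds add up. -/
theorem exists_eval_of_wp (e : Exp) : ∀ (env : List Val) (Q : Val → ℕ → Prop), wp e env Q →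
    ∃ v T, Q v T ∧ ∃ t, Eval indexProgram env e v t ∧ t ≤ T := by
  induction e with
  | var i => exact fun env Q ⟨v, h, hQ⟩ => ⟨v, 1, hQ, 1, .var h, le_rfl⟩
  | nil => exact fun env Q h => ⟨_, _, h, 1, .nil, le_rfl⟩
  | const k => exact fun env Q h => ⟨_, _, h, 1, .const, le_rfl⟩
  | cons e₁ e₂ ih₁ ih₂ =>
    intro env Q h
    obtain ⟨v₁, T₁, h, t₁, h₁, l₁⟩ := ih₁ _ _ h
    obtain ⟨v₂, T₂, h, t₂, h₂, l₂⟩ := ih₂ _ _ h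
    exact ⟨_, _, h, _, .cons h₁ h₂, by omega⟩
  | casePair e e₁ e₂ ih ih₁ ih₂ =>
    intro env Q h
    obtain ⟨v, T, h, t, he, l⟩ := ih _ _ h
    cases v with
    | nil =>
      obtain ⟨w, T₁, h, t₁, h₁, l₁⟩ := ih₂ _ _ h
      exact ⟨_, _, h, _, .casePair_nil he h₁, by omega⟩
    | num x =>
      obtain ⟨w, T₁, h, t₁, h₁, l₁⟩ := ih₂ _ _ h
      exact ⟨_, _, h, _, .casePair_num he h₁, by omega⟩
    | cons a b =>
      obtain ⟨w, T₁, h, t₁, h₁, l₁⟩ := ih₁ _ _ h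
      exact ⟨_, _, h, _, .casePair_cons he h₁, by omega⟩
  | add e₁ e₂ ih₁ ih₂ =>
    intro env Q h
    obtain ⟨v₁, T₁, h, t₁, h₁, l₁⟩ := ih₁ _ _ h
    obtain ⟨v₂, T₂, h, t₂, h₂, l₂⟩ := ih₂ _ _ h
    cases v₁ <;> try exact h.elim
    cases v₂ <;> try exact h.elim
    exact ⟨_, _, h, _, .add h₁ h₂, by omega⟩
  | sub e₁ e₂ ih₁ ih₂ =>
    intro env Q h
    obtain ⟨v₁, T₁, h, t₁, h₁, l₁⟩ := ih₁ _ _ h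
    obtain ⟨v₂, T₂, h, t₂, h₂, l₂⟩ := ih₂ _ _ h
    cases v₁ <;> try exact h.elim
    cases v₂ <;> try exact h.elim
    exact ⟨_, _, h, _, .sub h₁ h₂, by omega⟩
  | mul e₁ e₂ ih₁ ih₂ =>
    intro env Q h
    obtain ⟨v₁, T₁, h, t₁, h₁, l₁⟩ := ih₁ _ _ h
    obtain ⟨v₂, T₂, h, t₂, h₂, l₂⟩ := ih₂ _ _ h
    cases v₁ <;> try exact h.elim
    cases v₂ <;> try exact h.elim
    exact ⟨_, _, h, _, .mul h₁ h₂, by omega⟩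
  | ifLe e₁ e₂ e₃ e₄ ih₁ ih₂ ih₃ ih₄ =>
    intro env Q h
    obtain ⟨v₁, T₁, h, t₁, h₁, l₁⟩ := ih₁ _ _ h
    obtain ⟨v₂, T₂, h, t₂, h₂, l₂⟩ := ih₂ _ _ h
    obtain _ | x | _ := v₁ <;> try exact h.elim
    obtain _ | y | _ := v₂ <;> try exact h.elim
    by_cases hxy : x ≤ y
    · obtain ⟨v, T, h, t, h₃, l₃⟩ := ih₃ _ _ (h.1 hxy)
      exact ⟨_, _, h, _, .ifLe_true h₁ h₂ hxy h₃, by omega⟩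
    · obtain ⟨v, T, h, t, h₃, l₃⟩ := ih₄ _ _ (h.2 hxy)
      exact ⟨_, _, h, _, .ifLe_false h₁ h₂ hxy h₃, by omega⟩
  | letIn e₁ e₂ ih₁ ih₂ =>
    intro env Q h
    obtain ⟨v₁, T₁, h, t₁, h₁, l₁⟩ := ih₁ _ _ h
    obtain ⟨v₂, T₂, h, t₂, h₂, l₂⟩ := ih₂ _ _ h
    exact ⟨_, _, h, _, .letIn h₁ h₂, by omega⟩
  | call f e ih =>
    intro env Q h
    obtain ⟨v, T, ⟨r, T', ⟨body, t', hb, hc, l'⟩, h⟩, t, he, l⟩ := ih _ _ h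
    exact ⟨_, _, h, _, .call hb he hc, by omega⟩

def Yields (r : Val) (T : ℕ) (v : Val) (t : ℕ) : Prop := v = r ∧ t ≤ T

/-- The rule behind every statement about the program: unfold `wp` on the body, and at each call
supply a `Calls` fact, for recursive calls the induction hypothesis. -/
theorem Calls.of_wp {f : ℕ} {a r : Val} {T : ℕ} (body : Exp)
    (hb : indexProgram[f]? = some body) (h : wp body [a] (Yields r T)) :
    Calls f a r T := by
  obtain ⟨v, T', ⟨rfl, hT⟩, t, he, ht⟩ := exists_eval_of_wp _ _ _ h
  exact ⟨body, t, hb, he, ht.trans hT⟩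

theorem Calls.mono {f : ℕ} {a r : Val} {T T' : ℕ} (h : Calls f a r T) (hT : T ≤ T') :
    Calls f a r T' := by
  obtain ⟨body, t, hb, he, ht⟩ := h
  exact ⟨body, t, hb, he, ht.trans hT⟩

theorem Calls.runs {f : ℕ} {a r : Val} {T : ℕ} (h : Calls f a r T) :
    ∃ t, Runs indexProgram f a r t ∧ t ≤ T + 2 := by
  obtain ⟨body, t, hb, he, ht⟩ := h
  exact ⟨1 + t + 1, .call hb (.var rfl) he, by omega⟩

@[simp] theorem Val.onNum_num (x : ℝ) (k : ℝ → Prop) : (Val.num x).onNum k = k x := rfl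

@[simp] theorem Val.onPair_cons (a b : Val) (k : Val → Val → Prop) (k' : Prop) :
    (Val.cons a b).onPair k k' = k a b := rfl

@[simp] theorem Val.onPair_nil (k : Val → Val → Prop) (k' : Prop) :
    Val.nil.onPair k k' = k' := rfl

/-! ### Relative position of boxes -/

/-- Boxes of arbitrary dimension, as lists of their sides. -/
abbrev Sides : Type := List (ℝ × ℝ)

def encodeSide (r : ℝ × ℝ) : Val := .cons (.num r.1) (.num r.2)

def encodeSides (b : Sides) : Val := encodeList (b.map encodeSide)

@[simp] theorem encodeList_nil : encodeList [] = .nil := rfl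

@[simp] theorem encodeList_cons (a : Val) (l : List Val) :
    encodeList (a :: l) = .cons a (encodeList l) := rfl

@[simp] theorem encodeSides_nil : encodeSides [] = .nil := rfl

@[simp] theorem encodeSides_cons (a : ℝ × ℝ) (l : Sides) :
    encodeSides (a :: l) = .cons (.cons (.num a.1) (.num a.2)) (encodeSides l) := rfl

open scoped Classical in
/-- The position of the interval `r` relative to `p`: `0` if they have no inner point in common,
`1` if `p` contains `r`, and `2` otherwise. -/
noncomputable def relSide (p r : ℝ × ℝ) : ℕ :=
  if r.2 ≤ p.1 then 0 else if p.2 ≤ r.1 then 0 else if p.1 ≤ r.1 then if r.2 ≤ p.2 then 1 else 2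
  else 2

/-- The position of the box `r` relative to `b`: `0` if they have no inner point in common,
`1` if `b` contains `r`, and at least `2` otherwise. -/
noncomputable def relBox : Sides → Sides → ℕ
  | p :: b, r :: bx => relSide p r * relBox b bx
  | _, _ => 1

theorem calls_rel (p r : ℝ × ℝ) :
    Calls relFn (.cons (.cons (.num p.1) (.num p.2)) (.cons (.num r.1) (.num r.2)))
      (.num (relSide p r)) 30 := by
  refine .of_wp relBody rfl ?_
  simp [relBody, wp, relSide]
  split_ifs <;> simp_all [Yields]

theorem calls_cls (b bx : Sides) :
    Calls clsFn (.cons (encodeSides b) (encodeSides bx)) (.num (relBox b bx))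
      (50 * b.length + 10) := by
  induction b generalizing bx with
  | nil =>
    refine .of_wp clsBody rfl ?_
    simp [clsBody, wp, relBox, Yields]
  | cons p b ih =>
    cases bx with
    | nil =>
      refine .of_wp clsBody rfl ?_
      simp [clsBody, wp, relBox, Yields]
    | cons r bx =>
      refine .of_wp clsBody rfl ?_
      simp [clsBody, wp, relBox]
      refine ⟨_, _, calls_rel p r, ?_⟩
      simp
      refine ⟨_, _, ih bx, ?_⟩
      simp [Yields]
      omega

/-! ### Balanced binary trees -/

inductive BinTree (α : Type) : Type
  | leaf (a : α) : BinTree α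
  | node (l r : BinTree α) : BinTree α

namespace BinTree

variable {α : Type}

def encode (e : α → Val) : BinTree α → Val
  | leaf a => .cons .nil (e a)
  | node l r => .cons (l.encode e) (r.encode e)

def flatten : BinTree α → List α
  | leaf a => [a]
  | node l r => l.flatten ++ r.flatten

def depth : BinTree α → ℕ
  | leaf _ => 0
  | node l r => max l.depth r.depth + 1

def size : BinTree α → ℕ
  | leaf _ => 1
  | node l r => l.size + r.size + 1

theorem flatten_length_pos (t : BinTree α) : 0 < t.flatten.length := by
  induction t with
  | leaf a => simp [flatten]
  | node l r ihl ihr => simp [flatten]; omega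

theorem size_add_one (t : BinTree α) : t.size + 1 = 2 * t.flatten.length := by
  induction t with
  | leaf a => simp [flatten, size]
  | node l r ihl ihr => simp [flatten, size]; omega

theorem exists_encode_eq_cons (e : α → Val) (t : BinTree α) : ∃ a b, t.encode e = .cons a b := by
  cases t <;> simp [encode]

/-- Join neighbouring trees. -/
def pairUp : List (BinTree α) → List (BinTree α)
  | a :: b :: l => node a b :: pairUp l
  | l => l

theorem pairUp_length : ∀ l : List (BinTree α), (pairUp l).length = (l.length + 1) / 2
  | [] => by simp [pairUp]
  | [_] => by simp [pairUp]
  | a :: b :: l => by simp [pairUp, pairUp_length l]; omega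

theorem pairUp_flatten : ∀ l : List (BinTree α),
    (pairUp l).flatMap flatten = l.flatMap flatten
  | [] => by simp [pairUp]
  | [_] => by simp [pairUp]
  | a :: b :: l => by simp [pairUp, pairUp_flatten l, flatten]

theorem pairUp_depth {k : ℕ} : ∀ l : List (BinTree α), (∀ t ∈ l, t.depth ≤ k) →
    ∀ t ∈ pairUp l, t.depth ≤ k + 1
  | [], _ => by simp [pairUp]
  | [a], h => by simp [pairUp] at h ⊢; omega
  | a :: b :: l, h => by
    simp only [pairUp, List.mem_cons, forall_eq_or_imp] at h ⊢
    refine ⟨?_, pairUp_depth l h.2.2⟩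
    simp [depth]; omega

end BinTree

open BinTree

theorem calls_pair {α : Type} (e : α → Val) : ∀ l : List (BinTree α),
    Calls pairFn (encodeList (l.map (encode e))) (encodeList ((pairUp l).map (encode e)))
      (20 * l.length + 10)
  | [] => .of_wp pairBody rfl (by simp [pairBody, wp, pairUp, Yields])
  | [a] => .of_wp pairBody rfl (by simp [pairBody, wp, pairUp, Yields])
  | a :: b :: l => by
    refine .of_wp pairBody rfl ?_
    simp [pairBody, wp, pairUp]
    refine ⟨_, _, calls_pair e l, ?_⟩
    simp [encode, Yields]
    omega

/-- Each round of pairing halves the number of trees and adds one level. The costs form a geometric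
series, and the depth follows the recursion of `Nat.clog`. -/
theorem calls_loop {α : Type} (e : α → Val) {k : ℕ} (l : List (BinTree α)) (hl : l ≠ [])
    (hk : ∀ t ∈ l, t.depth ≤ k) :
    ∃ t : BinTree α, Calls loopFn (encodeList (l.map (encode e))) (t.encode e)
      (150 * l.length) ∧ t.flatten = l.flatMap flatten ∧
      t.depth ≤ k + Nat.clog 2 l.length := by
  induction hn : l.length using Nat.strong_induction_on generalizing l k with
  | _ n ih =>
    match l, hl with
    | [a], _ =>
      refine ⟨a, .of_wp loopBody rfl ?_, by simp, ?_⟩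
      · simp at hn
        simp [loopBody, wp, ← hn, Yields]
      · simp at hk; omega
    | a :: b :: l, _ =>
      have hlen := pairUp_length (a :: b :: l)
      have hs : (a :: b :: l).length = l.length + 2 := rfl
      rw [hs] at hlen hn
      obtain ⟨t, ht, hf, hd⟩ := ih _ (by omega) (pairUp (a :: b :: l)) (by simp [pairUp])
        (pairUp_depth _ hk) rfl
      refine ⟨t, .of_wp loopBody rfl ?_, by rw [hf, pairUp_flatten], ?_⟩
      · have := calls_pair e (a :: b :: l)
        simp [loopBody, wp]
        refine ⟨_, _, by simpa using this, _, _, ht, rfl, ?_⟩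
        rw [hlen]
        omega
      · rw [hlen] at hd
        rw [← hn, Nat.clog_of_two_le (by omega) (by omega)]
        have : (l.length + 2 + 2 - 1) / 2 = (l.length + 2 + 1) / 2 := by omega
        rw [this]
        omega

theorem calls_wrap {α : Type} (e : α → Val) (l : List α) :
    Calls wrapFn (encodeList (l.map e)) (encodeList ((l.map leaf).map (encode e)))
      (20 * l.length + 10) := by
  induction l with
  | nil => exact .of_wp wrapBody rfl (by simp [wrapBody, wp, Yields])
  | cons a l ih =>
    refine .of_wp wrapBody rfl ?_
    simp [wrapBody, wp]
    refine ⟨_, _, ih, ?_⟩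
    simp [encode, Yields]
    omega

/-- A nonempty list can be turned into a balanced tree in linear time. -/
theorem exists_balanced {α : Type} (e : α → Val) (l : List α) (hl : l ≠ []) :
    ∃ t : BinTree α, t.flatten = l ∧ t.depth ≤ Nat.clog 2 l.length ∧
      ∃ v, Calls wrapFn (encodeList (l.map e)) v (30 * l.length) ∧
        Calls loopFn v (t.encode e) (150 * l.length) := by
  have hp := List.length_pos_iff.2 hl
  obtain ⟨t, ht, hf, hd⟩ := calls_loop e (k := 0) (l.map leaf) (by simpa using hl)
    (by simp [depth])
  refine ⟨t, ?_, by simpa using hd, _, (calls_wrap e l).mono (by omega), by simpa using ht⟩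
  rw [hf, List.flatMap_map]
  simp [flatten]

/-! ### Sorting -/

/-- An end of the first side of a box, with the list of the other sides. -/
abbrev Entry : Type := ℝ × Sides

def encodeEntry (x : Entry) : Val := .cons (.num x.1) (encodeSides x.2)

def encodeEntries (l : List Entry) : Val := encodeList (l.map encodeEntry)

@[simp] theorem encodeEntries_nil : encodeEntries [] = .nil := rfl

@[simp] theorem encodeEntries_cons (a : Entry) (l : List Entry) :
    encodeEntries (a :: l) = .cons (encodeEntry a) (encodeEntries l) := rfl

abbrev SortedEntries (l : List Entry) : Prop := l.Pairwise fun a b => a.1 ≤ b.1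

theorem calls_merge : ∀ x y : List Entry,
    Calls mergeFn (.cons (encodeEntries x) (encodeEntries y))
      (encodeEntries (x.merge y fun a b => decide (a.1 ≤ b.1))) (40 * (x.length + y.length) + 10)
  | [], y => .of_wp mergeBody rfl (by simp [mergeBody, wp, Yields])
  | a :: x, [] => .of_wp mergeBody rfl (by simp [mergeBody, wp, Yields])
  | a :: x, b :: y => by
    refine .of_wp mergeBody rfl ?_
    have h₁ := calls_merge x (b :: y)
    have h₂ := calls_merge (a :: x) y
    simp only [encodeEntries_cons, encodeEntry] at h₁ h₂
    simp [mergeBody, wp, List.cons_merge_cons, encodeEntry]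
    constructor
    · intro h
      refine ⟨_, _, h₁, ?_⟩
      simp [h, encodeEntry, Yields]
      omega
    · intro h
      refine ⟨_, _, h₂, ?_⟩
      simp [not_le.2 h, encodeEntry, Yields]
      omega
termination_by x y => x.length + y.length

/-- Merge sort whose recursion follows a given balanced tree, so that no list has to be split. Each
level of the tree costs linear time. -/
theorem calls_msort (t : BinTree Entry) :
    ∃ l, Calls msortFn (t.encode encodeEntry) (encodeEntries l)
      (70 * (t.flatten.length * (t.depth + 1))) ∧ l.Perm t.flatten ∧ SortedEntries l := by
  induction t with
  | leaf a =>
    exact ⟨[a], .of_wp msortBody rfl (by simp [msortBody, wp, encode, flatten, depth, Yields]),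
      by simp [flatten], by simp⟩
  | node l r ihl ihr =>
    obtain ⟨x, hx, px, sx⟩ := ihl
    obtain ⟨y, hy, py, sy⟩ := ihr
    refine ⟨x.merge y fun a b => decide (a.1 ≤ b.1), ?_,
      (List.merge_perm_append ..).trans (px.append py), ?_⟩
    · refine .of_wp msortBody rfl ?_
      obtain ⟨a, b, hab⟩ := l.exists_encode_eq_cons encodeEntry
      have hm := calls_merge x y
      rw [px.length_eq, py.length_eq] at hm
      have hl := l.flatten_length_pos
      simp [msortBody, wp, encode, hab]
      rw [← hab]
      refine ⟨_, _, hx, _, _, hy, _, _, hm, rfl, ?_⟩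
      simp only [flatten, depth, List.length_append]
      have e₁ : l.flatten.length * (l.depth + 1) ≤
        l.flatten.length * (max l.depth r.depth + 1) := by gcongr; omega
      have e₂ : r.flatten.length * (r.depth + 1) ≤
        r.flatten.length * (max l.depth r.depth + 1) := by gcongr; omega
      have hr := r.flatten_length_pos
      have e₃ : (l.flatten.length + r.flatten.length) * (max l.depth r.depth + 1 + 1) =
        l.flatten.length * (max l.depth r.depth + 1) +
        r.flatten.length * (max l.depth r.depth + 1) +
        (l.flatten.length + r.flatten.length) := by ring
      rw [e₃]
      omega
    · have := List.pairwise_merge (le := fun a b : Entry => decide (a.1 ≤ b.1))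
        (by simp; intros; linarith) (by simp; intros; exact le_total _ _) x y
        (by simpa using sx) (by simpa using sy)
      simpa using this

open BinTree

/-! ### Sorted ends of the sides in every dimension -/

def encodeBoxList (bs : List Sides) : Val := encodeList (bs.map encodeSides)

@[simp] theorem encodeBoxList_nil : encodeBoxList [] = .nil := rfl

@[simp] theorem encodeBoxList_cons (a : Sides) (l : List Sides) :
    encodeBoxList (a :: l) = .cons (encodeSides a) (encodeBoxList l) := rfl

def entriesOf : List Sides → List Entry
  | (p :: tl) :: bs => (p.1, tl) :: (p.2, tl) :: entriesOf bs
  | _ => []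

def tailsOf : List Sides → List Sides
  | (_ :: tl) :: bs => tl :: tailsOf bs
  | _ => []

theorem calls_entries (bs : List Sides) :
    Calls entriesFn (encodeBoxList bs) (encodeEntries (entriesOf bs)) (40 * bs.length + 10) := by
  induction bs with
  | nil => exact .of_wp entriesBody rfl (by simp [entriesBody, wp, entriesOf, Yields])
  | cons b bs ih =>
    cases b with
    | nil => exact .of_wp entriesBody rfl (by simp [entriesBody, wp, entriesOf, Yields])
    | cons p tl =>
      refine .of_wp entriesBody rfl ?_
      simp [entriesBody, wp, entriesOf]
      refine ⟨_, _, ih, ?_⟩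
      simp [Yields, encodeEntry]
      omega

theorem calls_tails (bs : List Sides) :
    Calls tailsFn (encodeBoxList bs) (encodeBoxList (tailsOf bs)) (40 * bs.length + 10) := by
  induction bs with
  | nil => exact .of_wp tailsBody rfl (by simp [tailsBody, wp, tailsOf, Yields])
  | cons b bs ih =>
    cases b with
    | nil => exact .of_wp tailsBody rfl (by simp [tailsBody, wp, tailsOf, Yields])
    | cons p tl =>
      refine .of_wp tailsBody rfl ?_
      simp [tailsBody, wp, tailsOf]
      refine ⟨_, _, ih, ?_⟩
      simp [Yields]
      omega

theorem length_entriesOf {bs : List Sides} (h : ∀ b ∈ bs, b ≠ []) :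
    (entriesOf bs).length = 2 * bs.length := by
  induction bs with
  | nil => rfl
  | cons b bs ih =>
    cases b with
    | nil => simp at h
    | cons p tl =>
      simp [entriesOf, ih fun b hb => h b (List.mem_cons_of_mem _ hb)]
      ring

theorem tailsOf_eq_map {bs : List Sides} (h : ∀ b ∈ bs, b ≠ []) :
    tailsOf bs = bs.map List.tail := by
  induction bs with
  | nil => rfl
  | cons b bs ih =>
    cases b with
    | nil => simp at h
    | cons p tl => simp [tailsOf, ih fun b hb => h b (List.mem_cons_of_mem _ hb)]

def encodeDims (D : List (List Entry)) : Val := encodeList (D.map encodeEntries)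

@[simp] theorem encodeDims_nil : encodeDims [] = .nil := rfl

@[simp] theorem encodeDims_cons (a : List Entry) (l : List (List Entry)) :
    encodeDims (a :: l) = .cons (encodeEntries a) (encodeDims l) := rfl

/-- `D` lists, in reverse order, the sorted ends of the sides of the boxes in `B₀` for some of the
first dimensions, and `B` consists of the remaining sides of these boxes. -/
inductive SortedDims (B₀ : List Sides) : List (List Entry) → List Sides → Prop
  | nil : SortedDims B₀ [] B₀
  | cons {D : List (List Entry)} {B : List Sides} {l : List Entry} (h : SortedDims B₀ D B)
      (hB : ∀ b ∈ B, b ≠ []) (hl : SortedEntries l) (hp : l.Perm (entriesOf B)) :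
      SortedDims B₀ (l :: D) (tailsOf B)

/-- One dimension is stripped and sorted per round, and the end is recognized by the first box
having no sides left; hence the family must be nonempty. Results are pushed on the front, so the
last dimension ends up first, which is the order in which the construction consumes them. -/
theorem calls_sortDims {B₀ : List Sides} {k n : ℕ} (hn : n ≠ 0) {B : List Sides}
    {D : List (List Entry)} (h : SortedDims B₀ D B) (hB : B.length = n)
    (hk : ∀ b ∈ B, b.length = k) :
    ∃ D' B', Calls sortDimsFn (.cons (encodeBoxList B) (encodeDims D)) (encodeDims D')
      (k * (1000 * (n * (Nat.clog 2 (2 * n) + 1))) + 20) ∧ SortedDims B₀ D' B' ∧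
      D'.length = D.length + k := by
  induction k generalizing B D with
  | zero =>
    refine ⟨D, B, .of_wp sortDimsBody rfl ?_, h, rfl⟩
    match B, hB, hk with
    | b :: B, hB, hk =>
      have : b = [] := by simpa using hk b
      simp [sortDimsBody, wp, Yields, this]
    | [], hB, _ => exact absurd hB.symm hn
  | succ k ih =>
    have hne : ∀ b ∈ B, b ≠ [] := by
      rintro b hb rfl
      simpa using hk _ hb
    have hlen := length_entriesOf hne
    have hBn : entriesOf B ≠ [] := by
      rw [← List.length_pos_iff]
      omega
    obtain ⟨t, htf, htd, v, hw, hl⟩ := exists_balanced encodeEntry (entriesOf B) hBn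
    obtain ⟨l, hs, hp, hsl⟩ := calls_msort t
    rw [htf] at hp hs
    obtain ⟨D', B', hc, hD, hDl⟩ := ih (SortedDims.cons h hne hsl hp)
      (by rw [tailsOf_eq_map hne, List.length_map, hB])
      (by
        rw [tailsOf_eq_map hne]
        intro b hb
        obtain ⟨b', hb', rfl⟩ := List.mem_map.1 hb
        simp [hk b' hb'])
    refine ⟨D', B', .of_wp sortDimsBody rfl ?_, hD, by simp at hDl; omega⟩
    have h₁ := calls_entries B
    have h₂ := calls_tails B
    match B, hB, hk, hne with
    | (p :: b) :: B, hB, hk, hne =>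
      simp only [encodeBoxList_cons, encodeSides_cons] at h₁ h₂
      simp [sortDimsBody, wp]
      refine ⟨_, _, h₂, _, _, h₁, _, _, hw, _, _, hl, _, _, hs, _, _, hc, rfl, ?_⟩
      rw [hlen] at htd ⊢
      simp only [hB] at htd ⊢
      have e₁ : 2 * n * (t.depth + 1) ≤ 2 * (n * (Nat.clog 2 (2 * n) + 1)) := by
        rw [mul_assoc]; gcongr
      have e₂ : n ≤ n * (Nat.clog 2 (2 * n) + 1) := Nat.le_mul_of_pos_right _ (by omega)
      rw [add_mul]
      omega
    | [] :: B, _, _, hne => simp at hne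
    | [], hB, _, _ => exact absurd hB.symm hn

/-! ### Length of a list and integer square root -/

theorem calls_len (l : List Val) :
    Calls lenFn (encodeList l) (.num l.length) (20 * l.length + 10) := by
  induction l with
  | nil => exact .of_wp lenBody rfl (by simp [lenBody, wp, Yields])
  | cons a l ih =>
    refine .of_wp lenBody rfl ?_
    simp [lenBody, wp]
    refine ⟨_, _, ih, ?_⟩
    simp [Yields, add_comm]
    omega

/-- Linear search from `k` upwards for the first number whose square exceeds `n`; `j` is the number
of steps left. Time O(√n) is negligible here. -/
theorem calls_root (n : ℕ) {k j : ℕ} (hk : k + j = n.sqrt + 1) :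
    Calls rootFn (.cons (.num k) (.num n)) (.num (n.sqrt + 1 : ℕ)) (20 * j + 20) := by
  induction j generalizing k with
  | zero =>
    refine .of_wp rootBody rfl ?_
    have : ¬ (k : ℝ) * k ≤ n := by
      norm_cast
      rw [not_le, ← Nat.sqrt_lt]
      omega
    simp only [rootBody, wp]
    simp [Yields, this, ← hk]
  | succ j ih =>
    refine .of_wp rootBody rfl ?_
    have h : (k : ℝ) * k ≤ n := by
      norm_cast
      rw [← Nat.le_sqrt]
      omega
    have := ih (k := k + 1) (by omega)
    simp [rootBody, wp, h]
    refine ⟨_, _, by simpa using this, ?_⟩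
    simp [Yields]
    omega

/-! ### Weight trees -/

/-- A tree over a box of grid cells: a single cell, the union of two parts, or the product of a
tree over the first side and a tree over the remaining sides. The number `s` is the total
weight, and `m` is a factor that applies to the weights in both subtrees. -/
inductive WTree : Type
  | elem (bx : Sides) (s : ℝ) : WTree
  | split (bx : Sides) (m s : ℝ) (l r : WTree) : WTree
  | prod (bx : Sides) (m s : ℝ) (a c : WTree) : WTree

namespace WTree

def encode : WTree → Val
  | elem bx s => .cons (encodeSides bx) (.cons (.num s) .nil)
  | split bx m s l r => .cons (encodeSides bx) (.cons (.num s)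
      (.cons (.num m) (.cons .nil (.cons l.encode r.encode))))
  | prod bx m s a c => .cons (encodeSides bx) (.cons (.num s)
      (.cons (.num m) (.cons (.cons .nil .nil) (.cons a.encode c.encode))))

def box : WTree → Sides
  | elem bx _ => bx
  | split bx _ _ _ _ => bx
  | prod bx _ _ _ _ => bx

def sum : WTree → ℝ
  | elem _ s => s
  | split _ _ s _ _ => s
  | prod _ _ s _ _ => s

@[simp] theorem box_elem (bx : Sides) (s : ℝ) : (elem bx s).box = bx := rfl

@[simp] theorem box_split (bx : Sides) (m s : ℝ) (l r : WTree) :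
    (split bx m s l r).box = bx := rfl

@[simp] theorem box_prod (bx : Sides) (m s : ℝ) (a c : WTree) : (prod bx m s a c).box = bx := rfl

@[simp] theorem sum_elem (bx : Sides) (s : ℝ) : (elem bx s).sum = s := rfl

@[simp] theorem sum_split (bx : Sides) (m s : ℝ) (l r : WTree) : (split bx m s l r).sum = s := rfl

@[simp] theorem sum_prod (bx : Sides) (m s : ℝ) (a c : WTree) : (prod bx m s a c).sum = s := rfl

theorem exists_encode_eq (v : WTree) :
    ∃ a, v.encode = .cons (encodeSides v.box) (.cons (.num v.sum) a) := by
  cases v <;> simp [encode, box, sum]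

end WTree

open WTree

/-- The smallest box that contains `x` and `y`, if they only differ in one dimension and `x`
comes first. -/
def hullBox : Sides → Sides → Sides
  | p :: x, q :: y => (p.1, q.2) :: hullBox x y
  | _, _ => []

theorem hullBox_length : ∀ x y : Sides, (hullBox x y).length = min x.length y.length
  | p :: x, q :: y => by simp [hullBox, hullBox_length x y]
  | [], _ => by simp [hullBox]
  | _ :: _, [] => by simp [hullBox]

theorem calls_hull (x y : Sides) : Calls hullFn (.cons (encodeSides x) (encodeSides y))
    (encodeSides (hullBox x y)) (40 * x.length + 10) := by
  induction x generalizing y with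
  | nil => exact .of_wp hullBody rfl (by simp [hullBody, wp, hullBox, Yields])
  | cons p x ih =>
    cases y with
    | nil => exact .of_wp hullBody rfl (by simp [hullBody, wp, hullBox, Yields])
    | cons q y =>
      refine .of_wp hullBody rfl ?_
      simp [hullBody, wp, hullBox]
      refine ⟨_, _, ih y, ?_⟩
      simp [Yields]
      omega

/-! ### Joining, multiplying and chunking on the machine -/

def WTree.join (l r : WTree) : WTree := split (hullBox l.box r.box) 1 (l.sum + r.sum) l r

theorem calls_join (l r : WTree) : Calls joinFn (.cons l.encode r.encode) (l.join r).encode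
    (40 * l.box.length + 50) := by
  refine .of_wp joinBody rfl ?_
  obtain ⟨a, ha⟩ := l.exists_encode_eq
  obtain ⟨b, hb⟩ := r.exists_encode_eq
  simp [joinBody, wp, WTree.join, ha, hb]
  refine ⟨_, _, calls_hull _ _, ?_⟩
  simp [Yields, WTree.encode, ha, hb]
  omega

def BinTree.fold : BinTree WTree → WTree
  | leaf a => a
  | node l r => l.fold.join r.fold

theorem calls_fold {k : ℕ} (t : BinTree WTree) (hk : ∀ v ∈ t.flatten, v.box.length ≤ k) :
    Calls foldFn (t.encode WTree.encode) t.fold.encode ((40 * k + 100) * t.size) ∧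
      t.fold.box.length ≤ k := by
  induction t with
  | leaf a =>
    refine ⟨.of_wp foldBody rfl ?_, by simpa [flatten, fold] using hk⟩
    simp [foldBody, wp, BinTree.encode, fold, Yields, size]
  | node l r ihl ihr =>
    simp only [flatten, List.mem_append, or_imp, forall_and] at hk
    obtain ⟨hl, bl⟩ := ihl hk.1
    obtain ⟨hr, br⟩ := ihr hk.2
    refine ⟨.of_wp foldBody rfl ?_, ?_⟩
    · obtain ⟨a, b, hab⟩ := l.exists_encode_eq_cons WTree.encode
      simp [foldBody, wp, BinTree.encode, hab]
      rw [← hab]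
      refine ⟨_, _, hl, _, _, hr, _, _, calls_join _ _, rfl, ?_⟩
      simp only [size]
      rw [mul_add, mul_add]
      omega
    · simp only [fold, WTree.join, box_split, hullBox_length]
      exact (min_le_left _ _).trans bl

def WTree.times (a c : WTree) : WTree := prod (a.box.take 1 ++ c.box) 1 (a.sum * c.sum) a c

theorem calls_times (a c : WTree) :
    Calls timesFn (.cons a.encode c.encode) (a.times c).encode 50 := by
  refine .of_wp timesBody rfl ?_
  obtain ⟨x, hx⟩ := a.exists_encode_eq
  obtain ⟨y, hy⟩ := c.exists_encode_eq
  simp [timesBody, wp, times, hx, hy]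
  cases h : a.box with
  | nil => simp [Yields, WTree.encode, hx, hy, h]
  | cons r b => simp [Yields, WTree.encode, hx, hy, h]

/-- The tree for an elementary interval. Degenerate intervals contain no cells. -/
noncomputable def cellTree (r : ℝ × ℝ) : WTree := elem [r] (if r.2 ≤ r.1 then 0 else 1)

/-- Divide the intervals between the consecutive sorted ends of sides into chunks of length at most
`M`, such that the ends that belong to boxes which intersect `bx` partially divide chunks. -/
noncomputable def chunks (bx : Sides) (M : ℕ) : ℝ → List Entry → ℕ → List (List (ℝ × ℝ))
  | _, [], _ => []
  | x, e :: es, cnt =>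
    if M ≤ cnt + 1 ∨ 2 ≤ relBox e.2 bx then [(x, e.1)] :: chunks bx M e.1 es 0
    else match chunks bx M e.1 es (cnt + 1) with
      | c :: cs => ((x, e.1) :: c) :: cs
      | [] => [[(x, e.1)]]

noncomputable def encodeCells (c : List (ℝ × ℝ)) : Val :=
  encodeList (c.map fun r => (cellTree r).encode)

noncomputable def encodeChunks (cs : List (List (ℝ × ℝ))) : Val := encodeList (cs.map encodeCells)

@[simp] theorem encodeChunks_nil : encodeChunks [] = .nil := rfl

@[simp] theorem encodeChunks_cons (a : List (ℝ × ℝ)) (l : List (List (ℝ × ℝ))) :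
    encodeChunks (a :: l) = .cons (encodeCells a) (encodeChunks l) := rfl

theorem calls_cell (r : ℝ × ℝ) :
    Calls cellFn (.cons (.num r.1) (.num r.2)) (cellTree r).encode 20 := by
  refine .of_wp cellBody rfl ?_
  simp [cellBody, wp, cellTree, WTree.encode, Yields]

open scoped Classical in
theorem calls_cut (tl bx : Sides) (cnt M : ℕ) :
    Calls cutFn (.cons (encodeSides tl) (.cons (encodeSides bx) (.cons (.num cnt) (.num M))))
      (.num (if M ≤ cnt + 1 ∨ 2 ≤ relBox tl bx then 1 else 0)) (50 * tl.length + 50) := by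
  have hlt : (2 : ℝ) ≤ relBox tl bx ↔ 2 ≤ relBox tl bx := by norm_cast
  have hlm : (M : ℝ) ≤ cnt + 1 ↔ M ≤ cnt + 1 := by norm_cast
  refine .of_wp cutBody rfl ?_
  by_cases hm : M ≤ cnt + 1
  · simp [cutBody, wp, hlm, hm, Yields]
  · simp [cutBody, wp, hlm, hm]
    refine fun _ => ⟨_, _, calls_cls _ _, ?_⟩
    by_cases hc : 2 ≤ relBox tl bx
    · simp [Yields, hc]
      omega
    · simp [Yields, hc]
      omega

theorem calls_chunk {k : ℕ} (bx : Sides) (M : ℕ) (x : ℝ) (es : List Entry)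
    (hk : ∀ e ∈ es, e.2.length ≤ k) (cnt : ℕ) :
    Calls chunkFn (.cons (.num x) (.cons (encodeEntries es) (.cons (.num cnt)
      (.cons (encodeSides bx) (.num M))))) (encodeChunks (chunks bx M x es cnt))
      ((50 * k + 150) * es.length + 20) := by
  induction es generalizing x cnt with
  | nil => exact .of_wp chunkBody rfl (by simp [chunkBody, wp, chunks, Yields])
  | cons e es ih =>
    have hke := hk e (by simp)
    have ih := ih (hk := fun e he => hk e (List.mem_cons_of_mem _ he))
    have h₁ := ih e.1 0
    have h₂ := ih e.1 (cnt + 1)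
    have hcell := calls_cell (x, e.1)
    have hcut := calls_cut e.2 bx cnt M
    have ht : (50 * k + 150) * (es.length + 1) = (50 * k + 150) * es.length + 50 * k + 150 := by
      ring
    refine .of_wp chunkBody rfl ?_
    simp only [Nat.cast_zero, Nat.cast_add, Nat.cast_one] at h₁ h₂
    by_cases hc : M ≤ cnt + 1 ∨ 2 ≤ relBox e.2 bx
    · rw [if_pos hc] at hcut
      simp [chunkBody, wp, encodeEntry]
      refine ⟨_, _, hcut, ?_⟩
      simp
      refine ⟨_, _, hcell, _, _, h₁, ?_⟩
      simp [Yields, chunks, hc, encodeCells]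
      omega
    · rw [if_neg hc] at hcut
      simp [chunkBody, wp, encodeEntry]
      refine ⟨_, _, hcut, ?_⟩
      simp [not_le.2 (zero_lt_one (α := ℝ))]
      refine ⟨_, _, h₂, ?_⟩
      cases hcs : chunks bx M e.1 es (cnt + 1) with
      | nil =>
        simp
        refine ⟨_, _, hcell, ?_⟩
        simp [Yields, chunks, hc, hcs, encodeCells]
        omega
      | cons c cs =>
        simp
        refine ⟨_, _, hcell, ?_⟩
        simp [Yields, chunks, hc, hcs, encodeCells]
        omega

/-! ### Queries and updates -/

namespace WTree

/-- The total weight of the cells in a box. -/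
noncomputable def query : WTree → Sides → ℝ
  | elem bx s, b => if relBox b bx = 1 then s else 0
  | split bx m s l r, b => if relBox b bx = 0 then 0 else if relBox b bx = 1 then s else
      m * (l.query b + r.query b)
  | prod bx m s a c, b => if relBox b bx = 0 then 0 else if relBox b bx = 1 then s else
      match b with
      | h :: t => m * (a.query [h] * c.query t)
      | [] => 0

/-- Multiply the weights of the cells in a box by `α`. -/
noncomputable def update : WTree → Sides → ℝ → WTree
  | elem bx s, b, α => if relBox b bx = 1 then elem bx (s * α) else elem bx s
  | split bx m s l r, b, α => if relBox b bx = 0 then split bx m s l r else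
      if relBox b bx = 1 then split bx (m * α) (s * α) l r else
      split bx m (m * ((l.update b α).sum + (r.update b α).sum)) (l.update b α) (r.update b α)
  | prod bx m s a c, b, α => if relBox b bx = 0 then prod bx m s a c else
      if relBox b bx = 1 then prod bx (m * α) (s * α) a c else
      match b with
      | h :: t =>
        if relBox [h] a.box ≤ 1 then
          prod bx m (m * (a.sum * (c.update t α).sum)) a (c.update t α)
        else prod bx m (m * ((a.update [h] α).sum * c.sum)) (a.update [h] α) c
      | [] => prod bx m s a c

/-- A bound for the number of nodes that a query or an update visits. -/
noncomputable def visits : WTree → Sides → ℕ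
  | elem _ _, _ => 1
  | split bx _ _ l r, b => 1 + if relBox b bx ≤ 1 then 0 else l.visits b + r.visits b
  | prod bx _ _ a c, b => 1 + if relBox b bx ≤ 1 then 0 else
      match b with
      | h :: t => a.visits [h] + c.visits t
      | [] => 0

end WTree

theorem relBox_nil_left (bx : Sides) : relBox [] bx = 1 := by simp [relBox]

theorem calls_query {k : ℕ} (v : WTree) (b : Sides) (hb : b.length ≤ k) :
    Calls queryFn (.cons v.encode (encodeSides b)) (.num (v.query b))
      ((50 * k + 100) * v.visits b) := by
  induction v generalizing b with
  | elem bx s =>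
    refine .of_wp queryBody rfl ?_
    have hc := calls_cls b bx
    simp [queryBody, wp, WTree.encode]
    refine ⟨_, _, hc, ?_⟩
    obtain h | h | h : relBox b bx = 0 ∨ relBox b bx = 1 ∨ 2 ≤ relBox b bx := by omega
    · simp [h, query, visits, Yields]; omega
    · simp [h, query, visits, Yields]; omega
    · have h₀ : relBox b bx ≠ 0 := by omega
      have h₁ : ¬ relBox b bx ≤ 1 := by omega
      have h₂ : relBox b bx ≠ 1 := by omega
      simp [h₀, h₁, h₂, query, visits, Yields]; omega
  | split bx m s l r ihl ihr =>
    refine .of_wp queryBody rfl ?_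
    have hc := calls_cls b bx
    simp [queryBody, wp, WTree.encode]
    refine ⟨_, _, hc, ?_⟩
    obtain h | h | h : relBox b bx = 0 ∨ relBox b bx = 1 ∨ 2 ≤ relBox b bx := by omega
    · simp [h, query, visits, Yields]; omega
    · simp [h, query, visits, Yields]; omega
    · have h₀ : relBox b bx ≠ 0 := by omega
      have h₁ : ¬ relBox b bx ≤ 1 := by omega
      have h₂ : relBox b bx ≠ 1 := by omega
      simp [h₀, h₁]
      refine fun _ _ => ⟨_, _, ihl b hb, _, _, ihr b hb, ?_⟩
      simp [h₀, h₁, h₂, query, visits, Yields]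
      rw [mul_add (50 * k + 100), mul_add (50 * k + 100)]
      omega
  | prod bx m s a c iha ihc =>
    refine .of_wp queryBody rfl ?_
    have hc := calls_cls b bx
    simp [queryBody, wp, WTree.encode]
    refine ⟨_, _, hc, ?_⟩
    obtain h | h | h : relBox b bx = 0 ∨ relBox b bx = 1 ∨ 2 ≤ relBox b bx := by omega
    · simp [h, query, visits, Yields]; omega
    · simp [h, query, visits, Yields]; omega
    · have h₀ : relBox b bx ≠ 0 := by omega
      have h₁ : ¬ relBox b bx ≤ 1 := by omega
      have h₂ : relBox b bx ≠ 1 := by omega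
      cases b with
      | nil => simp [relBox_nil_left] at h
      | cons p t =>
        simp at hb
        simp [h₀, h₁]
        refine fun _ _ => ⟨_, _, by simpa using iha [p] (by simp; omega), _, _,
          ihc t (by omega), ?_⟩
        simp [h₀, h₁, h₂, query, visits, Yields]
        rw [mul_add (50 * k + 100), mul_add (50 * k + 100)]
        omega

theorem calls_updateSplit {bx b : Sides} {m α : ℝ} {l r l' r' : WTree} {T₁ T₂ : ℕ}
    (hl : Calls updateFn (.cons l.encode (.cons (encodeSides b) (.num α))) l'.encode T₁)
    (hr : Calls updateFn (.cons r.encode (.cons (encodeSides b) (.num α))) r'.encode T₂) :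
    Calls updateSplitFn (.cons (encodeSides bx) (.cons (.num m) (.cons l.encode (.cons r.encode
      (.cons (encodeSides b) (.num α)))))) (split bx m (m * (l'.sum + r'.sum)) l' r').encode
      (T₁ + T₂ + 100) := by
  obtain ⟨x, hx⟩ := l'.exists_encode_eq
  obtain ⟨y, hy⟩ := r'.exists_encode_eq
  refine .of_wp updateSplitBody rfl ?_
  simp [updateSplitBody, wp]
  refine ⟨_, _, hl, ?_⟩
  simp [hx]
  refine ⟨_, _, hr, ?_⟩
  simp [hy, hx, Yields, WTree.encode]
  omega

theorem calls_updateLeft {bx b : Sides} {m α : ℝ} {l r l' : WTree} {T₁ : ℕ}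
    (hl : Calls updateFn (.cons l.encode (.cons (encodeSides b) (.num α))) l'.encode T₁) :
    Calls updateLeftFn (.cons (encodeSides bx) (.cons (.num m) (.cons l.encode (.cons r.encode
      (.cons (encodeSides b) (.num α)))))) (prod bx m (m * (l'.sum * r.sum)) l' r).encode
      (T₁ + 100) := by
  obtain ⟨x, hx⟩ := l'.exists_encode_eq
  obtain ⟨y, hy⟩ := r.exists_encode_eq
  refine .of_wp updateLeftBody rfl ?_
  simp [updateLeftBody, wp]
  refine ⟨_, _, hl, ?_⟩
  simp [hx, hy, Yields, WTree.encode]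
  omega

theorem calls_updateRight {bx b : Sides} {m α : ℝ} {l r r' : WTree} {T₁ : ℕ}
    (hr : Calls updateFn (.cons r.encode (.cons (encodeSides b) (.num α))) r'.encode T₁) :
    Calls updateRightFn (.cons (encodeSides bx) (.cons (.num m) (.cons l.encode (.cons r.encode
      (.cons (encodeSides b) (.num α)))))) (prod bx m (m * (l.sum * r'.sum)) l r').encode
      (T₁ + 100) := by
  obtain ⟨x, hx⟩ := l.exists_encode_eq
  obtain ⟨y, hy⟩ := r'.exists_encode_eq
  refine .of_wp updateRightBody rfl ?_
  simp [updateRightBody, wp, hx]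
  refine ⟨_, _, hr, ?_⟩
  simp [hx, hy, Yields, WTree.encode]
  omega

/-- Only one factor is updated, and a comparison with the box of the first factor decides which.
Both times are charged all the same, in agreement with `visits`, which counts both factors. -/
theorem calls_updateProd {bx b : Sides} {p : ℝ × ℝ} {m α : ℝ} {l r l' r' : WTree} {T₁ T₂ : ℕ}
    (hl : Calls updateFn (.cons l.encode (.cons (encodeSides [p]) (.num α))) l'.encode T₁)
    (hr : Calls updateFn (.cons r.encode (.cons (encodeSides b) (.num α))) r'.encode T₂) :
    Calls updateProdFn (.cons (encodeSides bx) (.cons (.num m) (.cons l.encode (.cons r.encode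
      (.cons (encodeSides (p :: b)) (.num α)))))) (if relBox [p] l.box ≤ 1 then
        prod bx m (m * (l.sum * r'.sum)) l r' else prod bx m (m * (l'.sum * r.sum)) l' r).encode
      (T₁ + T₂ + 250) := by
  obtain ⟨x, hx⟩ := l.exists_encode_eq
  have hc := calls_cls [p] l.box
  have hl := calls_updateLeft (bx := bx) (m := m) (r := r) hl
  have hr := calls_updateRight (bx := bx) (m := m) (l := l) hr
  simp [hx] at hc hl hr
  refine .of_wp updateProdBody rfl ?_
  simp [updateProdBody, wp, hx]
  refine ⟨_, _, hc, ?_⟩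
  by_cases hp : relBox [p] l.box ≤ 1
  · simp [hp]
    refine ⟨_, _, hr, ?_⟩
    simp [Yields]
    omega
  · simp [hp]
    refine fun _ => ⟨_, _, hl, ?_⟩
    simp [Yields]
    omega

theorem calls_update {k : ℕ} (v : WTree) (b : Sides) (α : ℝ) (hb : b.length ≤ k) :
    Calls updateFn (.cons v.encode (.cons (encodeSides b) (.num α))) (v.update b α).encode
      ((100 * k + 400) * v.visits b) := by
  induction v generalizing b with
  | elem bx s =>
    have hc := calls_cls b bx
    have hr : Calls updateRootFn (.cons (encodeSides bx) (.cons (.num s) (.cons .nil (.num α))))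
        (elem bx (s * α)).encode 50 :=
      .of_wp updateRootBody rfl (by simp [updateRootBody, wp, Yields, WTree.encode])
    refine .of_wp updateBody rfl ?_
    simp [updateBody, wp, WTree.encode]
    refine ⟨_, _, hc, ?_⟩
    obtain h | h | h : relBox b bx = 0 ∨ relBox b bx = 1 ∨ 2 ≤ relBox b bx := by omega
    · simp [h, update, visits, Yields, WTree.encode]; omega
    · simp [h]
      refine ⟨_, _, hr, ?_⟩
      simp [h, update, visits, Yields, WTree.encode]; omega
    · have h₀ : relBox b bx ≠ 0 := by omega
      have h₁ : ¬ relBox b bx ≤ 1 := by omega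
      have h₂ : relBox b bx ≠ 1 := by omega
      simp [h₀, h₁, h₂, update, visits, Yields, WTree.encode]; omega
  | split bx m s l r ihl ihr =>
    have hc := calls_cls b bx
    have hs := calls_updateSplit (bx := bx) (m := m) (ihl b hb) (ihr b hb)
    have hr : Calls updateRootFn (.cons (encodeSides bx) (.cons (.num s) (.cons (.cons (.num m)
        (.cons .nil (.cons l.encode r.encode))) (.num α))))
        (split bx (m * α) (s * α) l r).encode 50 :=
      .of_wp updateRootBody rfl (by simp [updateRootBody, wp, Yields, WTree.encode])
    refine .of_wp updateBody rfl ?_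
    simp [updateBody, wp, WTree.encode]
    refine ⟨_, _, hc, ?_⟩
    obtain h | h | h : relBox b bx = 0 ∨ relBox b bx = 1 ∨ 2 ≤ relBox b bx := by omega
    · simp [h, update, visits, Yields, WTree.encode]; omega
    · simp [h]
      refine ⟨_, _, hr, ?_⟩
      simp [h, update, visits, Yields, WTree.encode]; omega
    · have h₀ : relBox b bx ≠ 0 := by omega
      have h₁ : ¬ relBox b bx ≤ 1 := by omega
      have h₂ : relBox b bx ≠ 1 := by omega
      simp [h₀, h₁]
      refine fun _ _ => ⟨_, _, hs, ?_⟩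
      simp [h₀, h₁, h₂, update, visits, Yields]
      rw [mul_add (100 * k + 400), mul_add (100 * k + 400)]
      omega
  | prod bx m s a c iha ihc =>
    have hc := calls_cls b bx
    have hr : Calls updateRootFn (.cons (encodeSides bx) (.cons (.num s) (.cons (.cons (.num m)
        (.cons (.cons .nil .nil) (.cons a.encode c.encode))) (.num α))))
        (prod bx (m * α) (s * α) a c).encode 50 :=
      .of_wp updateRootBody rfl (by simp [updateRootBody, wp, Yields, WTree.encode])
    refine .of_wp updateBody rfl ?_
    simp [updateBody, wp, WTree.encode]
    refine ⟨_, _, hc, ?_⟩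
    obtain h | h | h : relBox b bx = 0 ∨ relBox b bx = 1 ∨ 2 ≤ relBox b bx := by omega
    · simp [h, update, visits, Yields, WTree.encode]; omega
    · simp [h]
      refine ⟨_, _, hr, ?_⟩
      simp [h, update, visits, Yields, WTree.encode]; omega
    · have h₀ : relBox b bx ≠ 0 := by omega
      have h₁ : ¬ relBox b bx ≤ 1 := by omega
      have h₂ : relBox b bx ≠ 1 := by omega
      cases b with
      | nil => simp [relBox_nil_left] at h
      | cons p t =>
        simp at hb
        have hp := calls_updateProd (bx := bx) (m := m) (iha [p] (by simp; omega))
          (ihc t (by omega))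
        simp at hp
        simp [h₀, h₁]
        refine fun _ _ => ⟨_, _, hp, ?_⟩
        simp [h₀, h₁, h₂, update, visits, Yields]
        rw [mul_add (100 * k + 400), mul_add (100 * k + 400)]
        omega

open BinTree WTree

/-! ### Weight trees as discrete measures -/

/-- The point `p` lies in the interior of the box `bx`. -/
def Inside (p : List ℝ) (bx : Sides) : Prop :=
  List.Forall₂ (fun x (r : ℝ × ℝ) => r.1 < x ∧ x < r.2) p bx

/-- The point `p` lies in the closed box `bx`. -/
def InClosed (p : List ℝ) (bx : Sides) : Prop :=
  List.Forall₂ (fun x (r : ℝ × ℝ) => r.1 ≤ x ∧ x ≤ r.2) p bx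

theorem relSide_of_mem {p r : ℝ × ℝ} {x : ℝ} (h : r.1 < x ∧ x < r.2)
    (h' : p.1 ≤ x ∧ x ≤ p.2) : relSide p r ≠ 0 := by
  unfold relSide
  split_ifs <;> first | decide | linarith [h.1, h.2, h'.1, h'.2]

theorem mem_of_relSide {p r : ℝ × ℝ} {x : ℝ} (h : r.1 < x ∧ x < r.2) (hp : relSide p r = 1) :
    p.1 ≤ x ∧ x ≤ p.2 := by
  unfold relSide at hp
  split_ifs at hp <;> try omega
  constructor <;> linarith [h.1, h.2]

/-- Test points are interior to `bx`, so a closed box that merely touches `bx` misses them. -/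
theorem not_inClosed_of_relBox {p : List ℝ} {b bx : Sides} (hb : relBox b bx = 0)
    (h : Inside p bx) : ¬ InClosed p b := by
  intro h'
  induction h generalizing b with
  | nil => cases h'; simp [relBox] at hb
  | cons hx h ih =>
    cases h' with
    | cons hy h' =>
      simp only [relBox, mul_eq_zero] at hb
      exact hb.elim (relSide_of_mem hx hy) fun hb => ih hb h'

theorem inClosed_of_relBox {p : List ℝ} {b bx : Sides} (hl : b.length = bx.length)
    (hb : relBox b bx = 1) (h : Inside p bx) : InClosed p b := by
  induction h generalizing b with
  | nil => rw [List.length_nil, List.length_eq_zero_iff] at hl; subst hl; exact .nil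
  | cons hx h ih =>
    cases b with
    | nil => simp at hl
    | cons q b =>
      simp only [relBox, mul_eq_one] at hb
      exact .cons (mem_of_relSide hx hb.1) (ih (by simpa using hl) hb.2)

def Subbox (bx bz : Sides) : Prop :=
  List.Forall₂ (fun r q : ℝ × ℝ => q.1 ≤ r.1 ∧ r.2 ≤ q.2) bx bz

theorem Inside.mono {p : List ℝ} {bx bz : Sides} (h : Inside p bx) (hs : Subbox bx bz) :
    Inside p bz := by
  induction h generalizing bz with
  | nil => cases hs; exact .nil
  | cons hx h ih =>
    cases hs with
    | cons hy hs => exact .cons ⟨by linarith [hx.1, hy.1], by linarith [hx.2, hy.2]⟩ (ih hs)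

noncomputable def boxCenter (bx : Sides) : List ℝ := bx.map fun r => (r.1 + r.2) / 2

namespace WTree

/-- The integral of a function with respect to the weights of the cells. -/
noncomputable def integral : WTree → (List ℝ → ℝ) → ℝ
  | elem bx s, f => s * f (boxCenter bx)
  | split _ m _ l r, f => m * (l.integral f + r.integral f)
  | prod _ m _ a c, f => m * a.integral fun p => c.integral fun q => f (p ++ q)

def WellFormed : WTree → Prop
  | elem bx s => s = 0 ∨ ∀ r ∈ bx, r.1 < r.2
  | split bx m s l r => l.WellFormed ∧ r.WellFormed ∧ Subbox l.box bx ∧ Subbox r.box bx ∧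
      s = m * (l.sum + r.sum)
  | prod bx m s a c => a.WellFormed ∧ c.WellFormed ∧ (∃ r, a.box = [r] ∧ bx = r :: c.box) ∧
      s = m * (a.sum * c.sum)

/-- No cell intersects the box `b` partially, and no part with a product structure does so in more
than one factor. -/
def Good : WTree → Sides → Prop
  | elem bx _, b => relBox b bx ≤ 1
  | split _ _ _ l r, b => l.Good b ∧ r.Good b
  | prod bx _ _ a c, b => match b with
      | h :: t => a.Good [h] ∧ c.Good t ∧
          (relBox b bx = 0 ∨ relBox [h] a.box = 1 ∨ relBox t c.box = 1)
      | [] => False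

/-- The integral samples its argument only at centers of elementary cells. These are interior to all
enclosing boxes unless the cell is degenerate, and then its weight is 0. -/
theorem integral_congr {v : WTree} (hv : v.WellFormed) {f g : List ℝ → ℝ}
    (h : ∀ p, Inside p v.box → f p = g p) : v.integral f = v.integral g := by
  induction v generalizing f g with
  | elem bx s =>
    obtain rfl | hv := hv
    · simp [integral]
    · rw [integral, integral, h]
      simp only [box_elem, boxCenter, Inside, List.forall₂_map_left_iff]
      rw [List.forall₂_same]
      intro r hr
      have := hv r hr
      constructor <;> linarith
  | split bx m s l r ihl ihr =>
    obtain ⟨hl, hr, sl, sr, -⟩ := hv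
    rw [integral, integral, ihl hl fun p hp => h p (hp.mono sl),
      ihr hr fun p hp => h p (hp.mono sr)]
  | prod bx m s a c iha ihc =>
    obtain ⟨ha, hc, ⟨r, hr, rfl⟩, -⟩ := hv
    rw [integral, integral]
    congr 1
    refine iha ha fun p hp => ihc hc fun q hq => h _ ?_
    rw [hr] at hp
    cases hp with
    | cons hx hp => cases hp; exact .cons hx hq

theorem integral_const_mul (v : WTree) (k : ℝ) (f : List ℝ → ℝ) :
    v.integral (fun p => k * f p) = k * v.integral f := by
  induction v generalizing f with
  | elem bx s => simp only [integral]; ring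
  | split bx m s l r ihl ihr => simp only [integral, ihl, ihr]; ring
  | prod bx m s a c iha ihc => simp only [integral, iha, ihc]; ring

theorem integral_zero (v : WTree) : v.integral (fun _ => 0) = 0 := by
  simpa using v.integral_const_mul 0 fun _ => 0

theorem integral_one {v : WTree} (hv : v.WellFormed) : v.integral (fun _ => 1) = v.sum := by
  induction v with
  | elem bx s => simp [integral]
  | split bx m s l r ihl ihr =>
    obtain ⟨hl, hr, -, -, rfl⟩ := hv
    simp [integral, ihl hl, ihr hr]
  | prod bx m s a c iha ihc =>
    obtain ⟨ha, hc, -, rfl⟩ := hv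
    have := a.integral_const_mul c.sum fun _ => 1
    simp only [mul_one] at this
    simp [integral, ihc hc, this, iha ha, mul_comm]

/-- On a node that the box contains, a function defined by cases on the box may be replaced by its
inner branch; the next lemma does the same with the outer branch on a node that the box misses.
These are the two situations where queries and updates stop at a node. -/
theorem integral_mul_of_relBox_one {v : WTree} (hv : v.WellFormed) {b : Sides}
    (hl : b.length = v.box.length) (hb : relBox b v.box = 1) {f g h : List ℝ → ℝ}
    (hg : ∀ p, InClosed p b → g p = h p) :
    v.integral (fun p => f p * g p) = v.integral fun p => f p * h p :=
  integral_congr hv fun p hp => by rw [hg p (inClosed_of_relBox hl hb hp)]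

theorem integral_mul_of_relBox_zero {v : WTree} (hv : v.WellFormed) {b : Sides}
    (hb : relBox b v.box = 0) {f g h : List ℝ → ℝ} (hg : ∀ p, ¬ InClosed p b → g p = h p) :
    v.integral (fun p => f p * g p) = v.integral fun p => f p * h p :=
  integral_congr hv fun p hp => by rw [hg p (not_inClosed_of_relBox hb hp)]

end WTree

open scoped Classical in
/-- The function that takes the value `α` on the closed box `b` and `β` outside. -/
noncomputable def boxFun (b : Sides) (α β : ℝ) (p : List ℝ) : ℝ := if InClosed p b then α else β

theorem boxFun_of_mem {b : Sides} {α β : ℝ} {p : List ℝ} (h : InClosed p b) :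
    boxFun b α β p = α := if_pos h

theorem boxFun_of_not_mem {b : Sides} {α β : ℝ} {p : List ℝ} (h : ¬ InClosed p b) :
    boxFun b α β p = β := if_neg h

theorem inClosed_cons {h : ℝ × ℝ} {t : Sides} {p q : List ℝ} (hp : p.length = 1) :
    InClosed (p ++ q) (h :: t) ↔ InClosed p [h] ∧ InClosed q t := by
  obtain ⟨x, rfl⟩ := List.length_eq_one_iff.1 hp
  simp [InClosed]

namespace WTree

theorem box_update (v : WTree) (b : Sides) (α : ℝ) : (v.update b α).box = v.box := by
  cases v with
  | elem bx s => simp only [update]; split_ifs <;> rfl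
  | split bx m s l r => simp only [update]; split_ifs <;> rfl
  | prod bx m s a c => cases b <;> simp only [update] <;> split_ifs <;> rfl

theorem WellFormed.update {v : WTree} (hv : v.WellFormed) (b : Sides) (α : ℝ) :
    (v.update b α).WellFormed := by
  induction v generalizing b with
  | elem bx s =>
    simp only [WTree.update]
    split_ifs
    · exact hv.imp (by rintro rfl; simp) id
    · exact hv
  | split bx m s l r ihl ihr =>
    obtain ⟨hl, hr, sl, sr, e⟩ := id hv
    simp only [WTree.update]
    split_ifs
    · exact hv
    · exact ⟨hl, hr, sl, sr, by rw [e]; ring⟩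
    · exact ⟨ihl hl b, ihr hr b, by rwa [box_update], by rwa [box_update], rfl⟩
  | prod bx m s a c iha ihc =>
    obtain ⟨ha, hc, hbx, e⟩ := id hv
    cases b with
    | nil =>
      simp only [WTree.update]
      split_ifs
      · exact hv
      · exact ⟨ha, hc, hbx, by rw [e]; ring⟩
      · exact hv
    | cons h t =>
      simp only [WTree.update]
      split_ifs
      · exact hv
      · exact ⟨ha, hc, hbx, by rw [e]; ring⟩
      · exact ⟨ha, ihc hc t, by rwa [box_update], rfl⟩
      · exact ⟨iha ha [h], hc, by rwa [box_update], rfl⟩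

/-- This property, and likewise `visits` below, depends only on the shape and the boxes of the tree,
which updates leave alone. So both have to be established only once, for the initial tree. -/
theorem good_update (v : WTree) (b : Sides) (α : ℝ) (b' : Sides) :
    (v.update b α).Good b' ↔ v.Good b' := by
  induction v generalizing b b' with
  | elem bx s => simp only [update]; split_ifs <;> rfl
  | split bx m s l r ihl ihr =>
    simp only [update]
    split_ifs
    · rfl
    · rfl
    · simp only [Good, ihl, ihr]
  | prod bx m s a c iha ihc =>
    cases b with
    | nil => simp only [update]; split_ifs <;> rfl
    | cons h t =>
      simp only [update]
      split_ifs
      · rfl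
      · rfl
      · cases b' <;> simp only [Good, ihc, box_update]
      · cases b' <;> simp only [Good, iha, box_update]

theorem visits_update (v : WTree) (b : Sides) (α : ℝ) (b' : Sides) :
    (v.update b α).visits b' = v.visits b' := by
  induction v generalizing b b' with
  | elem bx s => simp only [update]; split_ifs <;> rfl
  | split bx m s l r ihl ihr =>
    simp only [update]
    split_ifs
    · rfl
    · rfl
    · simp only [visits, ihl, ihr]
  | prod bx m s a c iha ihc =>
    cases b with
    | nil => simp only [update]; split_ifs <;> rfl
    | cons h t =>
      simp only [update]
      split_ifs
      · rfl
      · rfl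
      · cases b' <;> simp only [visits, ihc]
      · cases b' <;> simp only [visits, iha]

/-- Queries are answered correctly. -/
theorem query_eq_integral {v : WTree} (hv : v.WellFormed) {b : Sides}
    (hl : b.length = v.box.length) (hg : v.Good b) : v.query b = v.integral (boxFun b 1 0) := by
  have h₀ : ∀ {v : WTree} {b : Sides}, v.WellFormed → relBox b v.box = 0 →
      v.integral (boxFun b 1 0) = 0 := fun {v b} hv hb => by
    simpa using (integral_mul_of_relBox_zero hv hb (f := fun _ => 1) (g := boxFun b 1 0)
      (h := fun _ => 0) fun p hp => boxFun_of_not_mem hp).trans (by simp [integral_zero])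
  have h₁ : ∀ {v : WTree} {b : Sides}, v.WellFormed → b.length = v.box.length →
      relBox b v.box = 1 → v.integral (boxFun b 1 0) = v.sum := fun {v b} hv hl hb => by
    simpa using (integral_mul_of_relBox_one hv hl hb (f := fun _ => 1) (g := boxFun b 1 0)
      (h := fun _ => 1) fun p hp => boxFun_of_mem hp).trans (by simp [integral_one hv])
  induction v generalizing b with
  | elem bx s =>
    simp only [query]
    split_ifs with h
    · exact (h₁ hv hl h).symm
    · have hb : relBox b bx ≤ 1 := hg
      exact (h₀ hv (by simp only [box_elem]; omega)).symm
  | split bx m s l r ihl ihr =>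
    simp only [query]
    split_ifs with h h'
    · exact (h₀ hv h).symm
    · exact (h₁ hv hl h').symm
    · obtain ⟨wl, wr, sl, sr, -⟩ := hv
      simp only [box_split] at hl
      rw [integral, ihl wl (by rw [hl, sl.length_eq]) hg.1, ihr wr (by rw [hl, sr.length_eq]) hg.2]
  | prod bx m s a c iha ihc =>
    simp only [query]
    split_ifs with h h'
    · exact (h₀ hv h).symm
    · exact (h₁ hv hl h').symm
    · obtain ⟨wa, wc, ⟨r, hr, rfl⟩, -⟩ := hv
      cases b with
      | nil => exact hg.elim
      | cons p t =>
        obtain ⟨ga, gc, -⟩ := hg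
        simp only [box_prod, List.length_cons, Nat.add_right_cancel_iff] at hl
        dsimp only
        rw [integral, iha wa (by simp [hr]) ga, ihc wc hl gc, mul_comm (a.integral _),
          ← integral_const_mul]
        congr 1
        -- The indicator of a product box is the product of the indicators, so the iterated integral
        -- factors. For queries the condition that only one factor is cut is not needed.
        refine integral_congr wa fun x hx => ?_
        have hx1 : x.length = 1 := by rw [hx.length_eq, hr]; rfl
        rw [mul_comm, ← integral_const_mul]
        congr 1
        ext q
        have e : InClosed (x ++ q) (p :: t) ↔ _ := inClosed_cons hx1
        simp only [boxFun, e]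
        split_ifs <;> simp_all

/-- Updates have the desired effect. -/
theorem integral_update {v : WTree} (hv : v.WellFormed) {b : Sides}
    (hl : b.length = v.box.length) (hg : v.Good b) (α : ℝ) (f : List ℝ → ℝ) :
    (v.update b α).integral f = v.integral fun p => f p * boxFun b α 1 p := by
  have h₀ : ∀ {v : WTree} {b : Sides}, v.WellFormed → relBox b v.box = 0 → ∀ f : List ℝ → ℝ,
      v.integral (fun p => f p * boxFun b α 1 p) = v.integral f := fun {v b} hv hb f => by
    simpa using integral_mul_of_relBox_zero hv hb (f := f) (g := boxFun b α 1)
      (h := fun _ => 1) fun p hp => boxFun_of_not_mem hp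
  have h₁ : ∀ {v : WTree} {b : Sides}, v.WellFormed → b.length = v.box.length →
      relBox b v.box = 1 → ∀ f : List ℝ → ℝ,
      v.integral (fun p => f p * boxFun b α 1 p) = α * v.integral f := fun {v b} hv hl hb f => by
    rw [integral_mul_of_relBox_one hv hl hb (f := f) (g := boxFun b α 1)
      (h := fun _ => α) fun p hp => boxFun_of_mem hp, ← integral_const_mul]
    simp only [mul_comm]
  induction v generalizing b f with
  | elem bx s =>
    simp only [update]
    split_ifs with h
    · rw [h₁ hv hl h]
      simp only [integral]
      ring
    · have hb : relBox b bx ≤ 1 := hg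
      rw [h₀ hv (by simp only [box_elem]; omega)]
  | split bx m s l r ihl ihr =>
    simp only [update]
    split_ifs with h h'
    · rw [h₀ hv h]
    · rw [h₁ hv hl h']
      simp only [integral]
      ring
    · obtain ⟨wl, wr, sl, sr, -⟩ := hv
      simp only [box_split] at hl
      rw [integral, integral, ihl wl (by rw [hl, sl.length_eq]) hg.1,
        ihr wr (by rw [hl, sr.length_eq]) hg.2]
  | prod bx m s a c iha ihc =>
    simp only [update]
    split_ifs with h h'
    · rw [h₀ hv h]
    · rw [h₁ hv hl h']
      simp only [integral]
      ring
    · obtain ⟨wa, wc, ⟨r, hr, rfl⟩, -⟩ := hv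
      cases b with
      | nil => exact hg.elim
      | cons p t =>
        obtain ⟨ga, gc, hcross⟩ := hg
        -- The function with value `α` on the box and 1 elsewhere is not a product in general. It
        -- depends on one factor alone as soon as the box contains the other factor, which is what
        -- `hcross` provides.
        have hcross := hcross.resolve_left h
        simp only [box_prod, List.length_cons, Nat.add_right_cancel_iff] at hl
        have hx1 : ∀ {x}, Inside x a.box → x.length = 1 := fun hx => by
          rw [hx.length_eq, hr]; rfl
        dsimp only
        split_ifs with hp
        -- The value 0 is impossible, as it would make the position relative to the whole product 0.
        -- So the box contains the first factor, and the change concerns the second one only.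
        · have hp1 : relBox [p] a.box = 1 := by
            have : relBox [p] a.box ≠ 0 := by
              rintro h0
              rw [hr] at h0
              simp only [relBox, mul_one] at h0
              exact h (by simp [relBox, h0])
            omega
          rw [integral, integral]
          congr 1
          refine integral_congr wa fun x hx => ?_
          rw [ihc wc hl gc]
          congr 1
          ext q
          have := inClosed_of_relBox (by simp [hr]) hp1 hx
          have e : InClosed (x ++ q) (p :: t) ↔ _ :=
            (inClosed_cons (hx1 hx)).trans (and_iff_right this)
          simp only [boxFun]
          rw [e]
        -- The first factor is cut, hence the box contains the second one and the change concerns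
        -- the first.
        · have ht1 := hcross.resolve_left (by omega)
          rw [integral, integral, iha wa (by simp [hr]) ga]
          congr 1
          refine integral_congr wa fun x hx => ?_
          rw [mul_comm, ← integral_const_mul]
          refine integral_congr wc fun q hq => ?_
          have := inClosed_of_relBox hl ht1 hq
          have e : InClosed (x ++ q) (p :: t) ↔ _ :=
            (inClosed_cons (hx1 hx)).trans (and_iff_left this)
          simp only [boxFun]
          rw [e]
          ring

end WTree

open BinTree WTree

/-! ### The number of visited nodes -/

/-- The number `a` lies in the interior of the side number `i` of the box. -/
def InnerCoord (bx : Sides) (i : ℕ) (a : ℝ) : Prop := ∃ r, bx[i]? = some r ∧ r.1 < a ∧ a < r.2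

open scoped Classical in
noncomputable def innerCount (bx : Sides) (i : ℕ) (a : ℝ) : ℕ := if InnerCoord bx i a then 1 else 0

theorem innerCount_le_one (bx : Sides) (i : ℕ) (a : ℝ) : innerCount bx i a ≤ 1 := by
  unfold innerCount
  split_ifs <;> omega

theorem innerCoord_cons_zero {r : ℝ × ℝ} {bx : Sides} {a : ℝ} :
    InnerCoord (r :: bx) 0 a ↔ r.1 < a ∧ a < r.2 := by simp [InnerCoord]

theorem innerCoord_cons_succ {r : ℝ × ℝ} {bx : Sides} {i : ℕ} {a : ℝ} :
    InnerCoord (r :: bx) (i + 1) a ↔ InnerCoord bx i a := by simp [InnerCoord]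

theorem InnerCoord.mono {bx bx' : Sides} {i : ℕ} {a : ℝ} (h : InnerCoord bx i a)
    (hs : Subbox bx bx') : InnerCoord bx' i a := by
  induction hs generalizing i with
  | nil => exact h
  | cons hr hs ih =>
    cases i with
    | zero =>
      rw [innerCoord_cons_zero] at h ⊢
      exact ⟨hr.1.trans_lt h.1, h.2.trans_le hr.2⟩
    | succ i =>
      rw [innerCoord_cons_succ] at h ⊢
      exact ih h

/-- The sum of `g i a` over the ends `a` of the sides of the box `b`, where `i` is the number of
the side. -/
def sumEnds : (ℕ → ℝ → ℕ) → Sides → ℕ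
  | _, [] => 0
  | g, r :: b => g 0 r.1 + g 0 r.2 + sumEnds (fun i => g (i + 1)) b

theorem sumEnds_add (g h : ℕ → ℝ → ℕ) (b : Sides) :
    sumEnds (fun i a => g i a + h i a) b = sumEnds g b + sumEnds h b := by
  induction b generalizing g h with
  | nil => rfl
  | cons r b ih => simp only [sumEnds, ih]; ring

theorem sumEnds_le {g : ℕ → ℝ → ℕ} {b : Sides} {X : ℕ} (h : ∀ i < b.length, ∀ a, g i a ≤ X) :
    sumEnds g b ≤ b.length * (2 * X) := by
  induction b generalizing g with
  | nil => simp [sumEnds]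
  | cons r b ih =>
    have := ih (g := fun i => g (i + 1)) fun i hi a => h _ (by simpa using hi) a
    have h₁ := h 0 (by simp) r.1
    have h₂ := h 0 (by simp) r.2
    simp only [sumEnds, List.length_cons, add_mul]
    omega

theorem inner_of_relSide {p r : ℝ × ℝ} (h : 2 ≤ relSide p r) :
    r.1 < p.1 ∧ p.1 < r.2 ∨ r.1 < p.2 ∧ p.2 < r.2 := by
  unfold relSide at h
  split_ifs at h <;> try omega
  · right; constructor <;> linarith
  · left; constructor <;> linarith

/-- A product of zeros and ones never reaches 2, so a partial intersection is partial in some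
dimension, and there an end of `b` lies strictly inside the side of `bx`. -/
theorem one_le_sumEnds {b bx : Sides} (h : 2 ≤ relBox b bx) :
    1 ≤ sumEnds (innerCount bx) b := by
  induction b generalizing bx with
  | nil => simp [relBox] at h
  | cons p b ih =>
    cases bx with
    | nil => simp [relBox] at h
    | cons r bx =>
      simp only [relBox] at h
      have e : (fun i => innerCount (r :: bx) (i + 1)) = innerCount bx := by
        ext i a
        unfold innerCount
        rw [innerCoord_cons_succ]
      simp only [sumEnds, e]
      by_cases hp : 2 ≤ relSide p r
      · obtain hi | hi := inner_of_relSide hp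
        · have : innerCount (r :: bx) 0 p.1 = 1 := by simp [innerCount, innerCoord_cons_zero, hi]
          omega
        · have : innerCount (r :: bx) 0 p.2 = 1 := by simp [innerCount, innerCoord_cons_zero, hi]
          omega
      · have : 2 ≤ relBox b bx := by
          have : relSide p r ≤ 1 := by omega
          nlinarith
        have := ih this
        omega

namespace WTree

/-- The number of inner nodes whose side number `i` contains `a` in its interior. -/
noncomputable def crossings : WTree → ℕ → ℝ → ℕ
  | elem _ _, _, _ => 0
  | split bx _ _ l r, i, a => innerCount bx i a + (l.crossings i a + r.crossings i a)
  | prod bx _ _ c _, 0, a => innerCount bx 0 a + c.crossings 0 a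
  | prod bx _ _ _ c, i + 1, a => innerCount bx (i + 1) a + c.crossings i a

/-- Every expanded node is charged to an end of `b` inside it. In a binary tree the visited nodes
number at most one more than twice the expanded ones. -/
theorem visits_le (v : WTree) (b : Sides) :
    v.visits b ≤ 1 + 2 * sumEnds v.crossings b := by
  induction v generalizing b with
  | elem bx s => simp [visits]
  | split bx m s l r ihl ihr =>
    have := ihl b
    have := ihr b
    have e : sumEnds (split bx m s l r).crossings b = sumEnds (innerCount bx) b +
        (sumEnds l.crossings b + sumEnds r.crossings b) := by
      simp only [← sumEnds_add]
      rfl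
    simp only [e, visits]
    split_ifs with h
    · omega
    · have := one_le_sumEnds (by omega : 2 ≤ relBox b bx)
      omega
  | prod bx m s a c iha ihc =>
    unfold visits
    split_ifs with h
    · omega
    · cases b with
      | nil => simp
      | cons p t =>
        have := one_le_sumEnds (by omega : 2 ≤ relBox (p :: t) bx)
        have h₁ := iha [p]
        have h₂ := ihc t
        simp only [sumEnds, crossings, sumEnds_add] at this h₁ h₂ ⊢
        have e := sumEnds_add (fun i => innerCount bx (i + 1)) c.crossings t
        omega

theorem crossings_eq_zero {v : WTree} (hv : v.WellFormed) {i : ℕ} {a : ℝ}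
    (h : ¬ InnerCoord v.box i a) : v.crossings i a = 0 := by
  induction v generalizing i with
  | elem bx s => rfl
  | split bx m s l r ihl ihr =>
    obtain ⟨hl, hr, sl, sr, -⟩ := hv
    simp only [box_split] at h
    simp [crossings, innerCount, h, ihl hl fun h' => h (h'.mono sl),
      ihr hr fun h' => h (h'.mono sr)]
  | prod bx m s x c iha ihc =>
    obtain ⟨ha, hc, ⟨r, hr, rfl⟩, -⟩ := hv
    simp only [box_prod] at h
    cases i with
    | zero =>
      simp only [crossings, innerCount, h, if_false, zero_add]
      exact iha ha (by rwa [hr, innerCoord_cons_zero, ← innerCoord_cons_zero (bx := c.box)])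
    | succ i =>
      simp only [crossings, innerCount, h, if_false, zero_add]
      exact ihc hc (by rwa [innerCoord_cons_succ] at h)

end WTree

/-! ### Combining trees for consecutive boxes -/

/-- The boxes of the trees only differ in one dimension, where they are consecutive intervals. -/
def ConsecBoxes (F C : Sides) : ℝ → List WTree → ℝ → Prop
  | x, [], y => x = y
  | x, v :: L, y => ∃ z, v.box = F ++ (x, z) :: C ∧ x ≤ z ∧ ConsecBoxes F C z L y

theorem consecBoxes_append {F C : Sides} {L L' : List WTree} {x y : ℝ} :
    ConsecBoxes F C x (L ++ L') y ↔ ∃ z, ConsecBoxes F C x L z ∧ ConsecBoxes F C z L' y := by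
  induction L generalizing x with
  | nil => simp [ConsecBoxes]
  | cons v L ih =>
    simp only [List.cons_append, ConsecBoxes, ih]
    constructor
    · rintro ⟨z, h₁, h₂, w, h₃, h₄⟩
      exact ⟨w, ⟨z, h₁, h₂, h₃⟩, h₄⟩
    · rintro ⟨w, ⟨z, h₁, h₂, h₃⟩, h₄⟩
      exact ⟨z, h₁, h₂, w, h₃, h₄⟩

theorem hullBox_self (F : Sides) : hullBox F F = F := by
  induction F with
  | nil => rfl
  | cons p F ih => simp [hullBox, ih]

theorem hullBox_append (F C : Sides) (p q : ℝ × ℝ) :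
    hullBox (F ++ p :: C) (F ++ q :: C) = F ++ (p.1, q.2) :: C := by
  induction F with
  | nil => simp [hullBox, hullBox_self]
  | cons p F ih => simp [hullBox, ih]

theorem Subbox.refl (bx : Sides) : Subbox bx bx := by
  rw [Subbox, List.forall₂_same]
  simp

theorem subbox_append {F C : Sides} {p q : ℝ × ℝ} (h : q.1 ≤ p.1 ∧ p.2 ≤ q.2) :
    Subbox (F ++ p :: C) (F ++ q :: C) := by
  induction F with
  | nil => exact .cons h (Subbox.refl C)
  | cons r F ih => exact .cons ⟨le_rfl, le_rfl⟩ ih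

theorem innerCoord_append {F C : Sides} {p : ℝ × ℝ} {a : ℝ} :
    InnerCoord (F ++ p :: C) F.length a ↔ p.1 < a ∧ a < p.2 := by
  simp [InnerCoord]

namespace BinTree

theorem box_fold {F C : Sides} (t : BinTree WTree) {x y : ℝ}
    (h : ConsecBoxes F C x t.flatten y) : t.fold.box = F ++ (x, y) :: C ∧ x ≤ y := by
  induction t generalizing x y with
  | leaf v =>
    obtain ⟨z, hv, hz, rfl⟩ := h
    exact ⟨hv, hz⟩
  | node l r ihl ihr =>
    obtain ⟨z, hl, hr⟩ := consecBoxes_append.1 h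
    obtain ⟨bl, xl⟩ := ihl hl
    obtain ⟨br, xr⟩ := ihr hr
    refine ⟨?_, xl.trans xr⟩
    rw [fold, WTree.join, box_split, bl, br, hullBox_append]

theorem wellFormed_fold {F C : Sides} (t : BinTree WTree) {x y : ℝ}
    (h : ConsecBoxes F C x t.flatten y) (hw : ∀ v ∈ t.flatten, v.WellFormed) :
    t.fold.WellFormed := by
  induction t generalizing x y with
  | leaf v => exact hw v (by simp [flatten])
  | node l r ihl ihr =>
    obtain ⟨z, hl, hr⟩ := consecBoxes_append.1 h
    simp only [flatten, List.mem_append, or_imp, forall_and] at hw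
    obtain ⟨bl, xl⟩ := box_fold l hl
    obtain ⟨br, xr⟩ := box_fold r hr
    refine ⟨ihl hl hw.1, ihr hr hw.2, ?_, ?_, by ring⟩
    · rw [bl, br, hullBox_append]
      exact subbox_append ⟨le_rfl, xr⟩
    · rw [bl, br, hullBox_append]
      exact subbox_append ⟨xl, le_rfl⟩

theorem integral_fold (t : BinTree WTree) (f : List ℝ → ℝ) :
    t.fold.integral f = (t.flatten.map fun v => v.integral f).sum := by
  induction t with
  | leaf v => simp [fold, flatten]
  | node l r ihl ihr => simp [fold, flatten, WTree.join, WTree.integral, ihl, ihr]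

theorem good_fold (t : BinTree WTree) {b : Sides} (h : ∀ v ∈ t.flatten, v.Good b) :
    t.fold.Good b := by
  induction t with
  | leaf v => exact h v (by simp [flatten])
  | node l r ihl ihr =>
    simp only [flatten, List.mem_append, or_imp, forall_and] at h
    exact ⟨ihl h.1, ihr h.2⟩

/-- Crude bound for dimensions other than the one being joined: all subtrees may be crossed. The
added 1 absorbs the joining nodes, of which there is one fewer than there are leaves. -/
theorem crossings_fold_add_one_le (t : BinTree WTree) {i : ℕ} {a : ℝ} {X : ℕ}
    (h : ∀ v ∈ t.flatten, v.crossings i a ≤ X) :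
    t.fold.crossings i a + 1 ≤ t.flatten.length * (X + 1) := by
  induction t with
  | leaf v => simpa [fold, flatten] using h
  | node l r ihl ihr =>
    simp only [flatten, List.mem_append, or_imp, forall_and] at h
    have h₁ := ihl h.1
    have h₂ := ihr h.2
    have h₃ := innerCount_le_one (hullBox l.fold.box r.fold.box) i a
    simp only [fold, flatten, WTree.join, crossings, List.length_append, add_mul _ _ (X + 1)]
    omega

/-- In the dimension being joined the boxes are consecutive, so `a` is interior to at most one of
them. Only one path from the root contributes, and it adds the depth instead of a factor. -/
theorem crossings_fold_le {F C : Sides} (t : BinTree WTree) {x y : ℝ}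
    (h : ConsecBoxes F C x t.flatten y) (hw : ∀ v ∈ t.flatten, v.WellFormed) {a : ℝ} {X : ℕ}
    (hX : ∀ v ∈ t.flatten, v.crossings F.length a ≤ X) :
    t.fold.crossings F.length a ≤ t.depth + X := by
  induction t generalizing x y with
  | leaf v => simpa [fold, flatten, depth] using hX
  | node l r ihl ihr =>
    obtain ⟨z, hl, hr⟩ := consecBoxes_append.1 h
    simp only [flatten, List.mem_append, or_imp, forall_and] at hw hX
    have h₁ := ihl hl hw.1 hX.1
    have h₂ := ihr hr hw.2 hX.2
    have h₃ := innerCount_le_one (hullBox l.fold.box r.fold.box) F.length a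
    simp only [fold, WTree.join, crossings, depth]
    by_cases hz : a < z
    · have : r.fold.crossings F.length a = 0 := by
        refine crossings_eq_zero (wellFormed_fold r hr hw.2) ?_
        rw [(box_fold r hr).1, innerCoord_append]
        exact fun h => lt_asymm h.1 hz
      omega
    · have : l.fold.crossings F.length a = 0 := by
        refine crossings_eq_zero (wellFormed_fold l hl hw.1) ?_
        rw [(box_fold l hl).1, innerCoord_append]
        exact fun h => hz h.2
      omega

end BinTree

/-! ### Chunks -/

/-- The intervals between consecutive ends. -/
def intervals : ℝ → List Entry → List (ℝ × ℝ)
  | _, [] => []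
  | x, e :: es => (x, e.1) :: intervals e.1 es

theorem flatten_chunks (bx : Sides) (M : ℕ) (x : ℝ) (es : List Entry) (cnt : ℕ) :
    (chunks bx M x es cnt).flatten = intervals x es := by
  induction es generalizing x cnt with
  | nil => rfl
  | cons e es ih =>
    rw [chunks]
    split_ifs with h
    · simp [intervals, ih]
    · have := ih e.1 (cnt + 1)
      revert this
      cases chunks bx M e.1 es (cnt + 1) with
      | nil => intro this; simp [intervals, ← this]
      | cons c cs => intro this; simp [intervals, ← this]

theorem length_intervals (x : ℝ) (es : List Entry) : (intervals x es).length = es.length := by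
  induction es generalizing x with
  | nil => rfl
  | cons e es ih => simp [intervals, ih]

/-- A cut either closes a chunk of `M` intervals, of which `cnt` were collected beforehand, or is
charged to an end of a box that meets `bx` partially; the 1 accounts for the last chunk. Multiplying
by `M` avoids division. -/
theorem mul_length_chunks_le (bx : Sides) (M : ℕ) (x : ℝ) (es : List Entry) (cnt : ℕ) :
    M * (chunks bx M x es cnt).length ≤
      M * (1 + es.countP fun e => 2 ≤ relBox e.2 bx) + es.length + cnt := by
  induction es generalizing x cnt with
  | nil => simp [chunks]
  | cons e es ih =>
    rw [chunks]
    have hc : es.countP (fun e => decide (2 ≤ relBox e.2 bx)) ≤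
      (e :: es).countP (fun e => decide (2 ≤ relBox e.2 bx)) :=
      (List.sublist_cons_self e es).countP_le
    have hM : M * (1 + es.countP fun e => decide (2 ≤ relBox e.2 bx)) ≤
      M * (1 + (e :: es).countP fun e => decide (2 ≤ relBox e.2 bx)) := by gcongr
    split_ifs with h
    · have h₀ := ih e.1 0
      rw [List.length_cons, mul_add, List.length_cons]
      obtain h | h := h
      · omega
      · rw [List.countP_cons_of_pos (by simpa using h)]
        rw [mul_add] at h₀ ⊢
        rw [mul_add]
        omega
    · have h₀ := ih e.1 (cnt + 1)
      revert h₀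
      cases chunks bx M e.1 es (cnt + 1) with
      | nil =>
        intro _
        have : M * 1 ≤ M * (1 + (e :: es).countP fun e => decide (2 ≤ relBox e.2 bx)) := by
          gcongr; omega
        simp only [List.length_cons, List.length_nil]
        omega
      | cons c cs =>
        intro h₀
        simp only [List.length_cons] at h₀ ⊢
        omega

def ConsecIntervals : ℝ → List (ℝ × ℝ) → ℝ → Prop
  | x, [], y => x = y
  | x, r :: c, y => r.1 = x ∧ x ≤ r.2 ∧ ConsecIntervals r.2 c y

theorem ConsecIntervals.le {c : List (ℝ × ℝ)} {x y : ℝ} (h : ConsecIntervals x c y) : x ≤ y := by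
  induction c generalizing x with
  | nil => exact le_of_eq h
  | cons r c ih => exact h.2.1.trans (ih h.2.2)

theorem ConsecIntervals.le_of_mem {c : List (ℝ × ℝ)} {x y : ℝ} (h : ConsecIntervals x c y)
    {r : ℝ × ℝ} (hr : r ∈ c) : x ≤ r.1 := by
  induction c generalizing x with
  | nil => simp at hr
  | cons q c ih =>
    obtain ⟨rfl, h₁, h₂⟩ := h
    obtain rfl | hr := List.mem_cons.1 hr
    · exact le_rfl
    · exact h₁.trans (ih h₂ hr)

/-- The intervals in `c` cover the interval from `x` to `z`, which contains only few of the ends in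
`S` and none that belong to a box that intersects `bx` partially. -/
structure IsChunk (bx : Sides) (M : ℕ) (S : List Entry) (x : ℝ) (c : List (ℝ × ℝ)) (z : ℝ) :
    Prop where
  ne_nil : c ≠ []
  consec : ConsecIntervals x c z
  special : ∀ e ∈ S, 2 ≤ relBox e.2 bx → e.1 ≤ x ∨ z ≤ e.1
  countP_le : S.countP (fun e => x < e.1 ∧ e.1 < z) ≤ M
  length_le : c.length ≤ M
  cell : ∀ r ∈ c, ∀ e ∈ S, e.1 ≤ r.1 ∨ r.2 ≤ e.1

theorem IsChunk.cons {bx : Sides} {M : ℕ} {S : List Entry} {x : ℝ} {c : List (ℝ × ℝ)} {z : ℝ}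
    (h : IsChunk bx M S x c z) {e : Entry} (he : e.1 ≤ x) : IsChunk bx M (e :: S) x c z where
  ne_nil := h.ne_nil
  consec := h.consec
  special := by
    simp only [List.mem_cons, forall_eq_or_imp]
    exact ⟨fun _ => .inl he, h.special⟩
  countP_le := by
    rw [List.countP_cons_of_neg (by simp [he])]
    exact h.countP_le
  length_le := h.length_le
  cell := fun r hr => by
    simp only [List.mem_cons, forall_eq_or_imp]
    exact ⟨.inl (he.trans (h.consec.le_of_mem hr)), h.cell r hr⟩

def ConsecChunks (bx : Sides) (M : ℕ) (S : List Entry) :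
    ℝ → List (List (ℝ × ℝ)) → ℝ → Prop
  | x, [], y => x = y
  | x, c :: cs, y => ∃ z, IsChunk bx M S x c z ∧ ConsecChunks bx M S z cs y

theorem ConsecChunks.cons {bx : Sides} {M : ℕ} {S : List Entry} {x : ℝ} {cs : List (List (ℝ × ℝ))}
    {y : ℝ} (h : ConsecChunks bx M S x cs y) {e : Entry} (he : e.1 ≤ x) :
    ConsecChunks bx M (e :: S) x cs y := by
  induction cs generalizing x with
  | nil => exact h
  | cons c cs ih =>
    obtain ⟨z, hc, h⟩ := h
    exact ⟨z, hc.cons he, ih h (he.trans hc.consec.le)⟩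

def lastCoord : ℝ → List Entry → ℝ
  | x, [] => x
  | _, e :: es => lastCoord e.1 es

/-- The last three conclusions, about the ends below `z`, the special ends and the room left in the
first chunk, are there for the induction: they allow one more interval to be put in front of that
chunk. -/
theorem exists_consecChunks {bx : Sides} {M : ℕ} {e₀ : Entry} {es : List Entry} {cnt : ℕ}
    (hs : SortedEntries (e₀ :: es)) (hM : cnt < M) (hes : es ≠ []) :
    ∃ c cs z, chunks bx M e₀.1 es cnt = c :: cs ∧ IsChunk bx M (e₀ :: es) e₀.1 c z ∧
      ConsecChunks bx M (e₀ :: es) z cs (lastCoord e₀.1 es) ∧ es.countP (fun e => e.1 < z) + 1 ≤ c.length ∧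
      (∀ e ∈ es, 2 ≤ relBox e.2 bx → z ≤ e.1) ∧ c.length + cnt ≤ M := by
  induction es generalizing e₀ cnt with
  | nil => exact absurd rfl hes
  | cons e es ih =>
    simp only [SortedEntries, List.pairwise_cons, List.mem_cons, forall_eq_or_imp] at hs
    obtain ⟨⟨h₀, h₀'⟩, h₁, h₂⟩ := hs
    have hs' : SortedEntries (e :: es) := List.pairwise_cons.2 ⟨h₁, h₂⟩
    have single : IsChunk bx M (e₀ :: e :: es) e₀.1 [(e₀.1, e.1)] e.1 := by
      refine ⟨by simp, ⟨rfl, h₀, rfl⟩, ?_, ?_, by simp; omega, ?_⟩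
      · simpa [h₀] using fun a b hab _ => Or.inr (h₁ (a, b) hab)
      · rw [List.countP_eq_zero.2]
        · omega
        · simpa using fun a b hab _ => h₁ (a, b) hab
      · simpa [h₀] using fun a b hab => Or.inr (h₁ (a, b) hab)
    have hcount : (e :: es).countP (fun a => decide (a.1 < e.1)) = 0 := by
      rw [List.countP_eq_zero]
      simpa using fun a b hab => h₁ (a, b) hab
    have hspec : ∀ a ∈ e :: es, 2 ≤ relBox a.2 bx → e.1 ≤ a.1 := by
      simpa using fun a b hab _ => h₁ (a, b) hab
    rw [chunks]
    split_ifs with h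
    · have hrest : ConsecChunks bx M (e₀ :: e :: es) e.1 (chunks bx M e.1 es 0)
          (lastCoord e.1 es) := by
        by_cases hes : es = []
        · subst hes; exact rfl
        · obtain ⟨c, cs, z, hcs, hc, hcc, -⟩ := ih (cnt := 0) hs' (by omega) hes
          rw [hcs]
          exact ⟨z, hc.cons h₀, hcc.cons (h₀.trans hc.consec.le)⟩
      exact ⟨_, _, e.1, rfl, single, hrest, by simp [hcount], hspec, by simp; omega⟩
    · push Not at h
      by_cases hes : es = []
      · subst hes
        exact ⟨_, _, e.1, rfl, single, rfl, by simp, hspec, by simp; omega⟩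
      · obtain ⟨c, cs, z, hcs, hc, hcc, hlt, hsp, hlen⟩ := ih (cnt := cnt + 1) hs' h.1 hes
        rw [hcs]
        have hez := hc.consec.le
        have hlt' : (e :: es).countP (fun a => decide (a.1 < z)) + 1 ≤
            ((e₀.1, e.1) :: c).length := by
          rw [List.countP_cons, List.length_cons]
          split_ifs <;> omega
        have hsp' : ∀ a ∈ e :: es, 2 ≤ relBox a.2 bx → z ≤ a.1 := by
          simp only [List.mem_cons, forall_eq_or_imp]
          exact ⟨fun h' => absurd h' (by omega), hsp⟩
        refine ⟨_, _, z, rfl, ⟨by simp, ⟨rfl, h₀, hc.consec⟩, ?_, ?_, by simp; omega, ?_⟩,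
          hcc.cons (h₀.trans hez), hlt', hsp', by simp; omega⟩
        · simp only [List.mem_cons (a := _) (b := e₀), forall_eq_or_imp]
          exact ⟨fun _ => .inl le_rfl, fun a ha h' => .inr (hsp' a ha h')⟩
        · rw [List.countP_cons_of_neg (by simp)]
          refine (List.countP_mono_left (q := fun a => decide (a.1 < z)) ?_).trans ?_
          · simp
          · simp only [List.length_cons] at hlt'
            omega
        · intro r hr
          obtain rfl | hr := List.mem_cons.1 hr
          · simpa [h₀] using fun a b hab => Or.inr (h₁ (a, b) hab)
          · have := hc.consec.le_of_mem hr
            rw [List.forall_mem_cons]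
            exact ⟨.inl (h₀.trans this), hc.cell r hr⟩

open BinTree WTree

/-! ### Building the tree -/

/-- The number of grid cells in an interval between two consecutive ends. -/
noncomputable def cellCount (r : ℝ × ℝ) : ℝ := if r.2 ≤ r.1 then 0 else 1

noncomputable def cellSum (c : List (ℝ × ℝ)) (g : ℝ → ℝ) : ℝ :=
  (c.map fun r => cellCount r * g ((r.1 + r.2) / 2)).sum

theorem consecBoxes_map_cellTree {x y : ℝ} {c : List (ℝ × ℝ)} (h : ConsecIntervals x c y) :
    ConsecBoxes [] [] x (c.map cellTree) y := by
  induction c generalizing x with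
  | nil => exact h
  | cons r c ih =>
    obtain ⟨rfl, h₁, h₂⟩ := h
    exact ⟨r.2, rfl, h₁, ih h₂⟩

theorem relSide_le_one {p r : ℝ × ℝ} (h₁ : p.1 ≤ r.1 ∨ r.2 ≤ p.1) (h₂ : p.2 ≤ r.1 ∨ r.2 ≤ p.2) :
    relSide p r ≤ 1 := by
  unfold relSide
  split_ifs <;> first | omega | grind

/-- A balanced tree for the cells of a chunk in one dimension. -/
theorem exists_chunkTree {bx : Sides} {M : ℕ} {S : List Entry} {x z : ℝ} {c : List (ℝ × ℝ)}
    (h : IsChunk bx M S x c z) :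
    ∃ T : WTree, (∃ v w, Calls wrapFn (encodeCells c) v (30 * c.length) ∧
        Calls loopFn v w (150 * c.length) ∧ Calls foldFn w T.encode (280 * c.length)) ∧
      T.box = [(x, z)] ∧ T.WellFormed ∧
      (∀ f, T.integral f = cellSum c fun a => f [a]) ∧
      (∀ a, T.crossings 0 a ≤ Nat.clog 2 M) ∧
      ∀ p : ℝ × ℝ, (∀ r ∈ c, relSide p r ≤ 1) → T.Good [p] := by
  obtain ⟨t, ht, hd, v, hw, hl⟩ := exists_balanced WTree.encode (c.map cellTree)
    (by simpa using h.ne_nil)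
  have hwf : ∀ v ∈ t.flatten, v.WellFormed := by
    rw [ht]
    simp only [List.mem_map, forall_exists_index, and_imp, forall_apply_eq_imp_iff₂]
    intro r _
    by_cases hr : r.2 ≤ r.1
    · left; simp [hr]
    · right; simpa using hr
  have hc := consecBoxes_map_cellTree h.consec
  rw [← ht] at hc
  obtain ⟨hb, -⟩ := box_fold t hc
  have hf := (calls_fold t (k := 1) (by
    rw [ht]
    intro v hv
    obtain ⟨r, -, rfl⟩ := List.mem_map.1 hv
    simp [cellTree])).1
  have hs := t.size_add_one
  rw [ht] at hs
  simp only [List.length_map, List.map_map] at *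
  refine ⟨t.fold, ⟨v, _, hw, hl, hf.mono (by omega)⟩, hb, wellFormed_fold t hc hwf, ?_, ?_, ?_⟩
  · intro f
    rw [integral_fold, ht, cellSum, List.map_map]
    congr 1
  · intro a
    -- Elementary cells have no inner nodes, hence `X = 0` and only the depth remains.
    have := crossings_fold_le t hc hwf (a := a) (X := 0) (by
      rw [ht]
      intro v hv
      obtain ⟨r, -, rfl⟩ := List.mem_map.1 hv
      simp [cellTree, crossings])
    have hm := Nat.clog_mono_right 2 h.length_le
    simp only [List.length_nil] at this
    omega
  · intro p hp
    refine good_fold t ?_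
    rw [ht]
    simp only [List.mem_map, forall_exists_index, and_imp, forall_apply_eq_imp_iff₂]
    intro r hr
    simpa [cellTree, Good, relBox] using hp r hr

noncomputable def sideSum : List Entry → (ℝ → ℝ) → ℝ
  | [], _ => 0
  | e :: es, g => cellSum (intervals e.1 es) g

/-- The sum of a function over the points of a grid that is given by the sorted ends of the sides
of boxes, in reverse order of the dimensions. -/
noncomputable def gridSum : List (List Entry) → (List ℝ → ℝ) → ℝ
  | [], f => f []
  | S :: D, f => gridSum D fun p => sideSum S fun a => f (p ++ [a])

/-- Sides are appended at the end because the dimensions come in reverse order. The side `(0, 0)` is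
a default that only keeps the number of sides right; a nonempty family never produces an empty list
of ends. -/
def fullBox : List (List Entry) → Sides
  | [] => []
  | [] :: D => fullBox D ++ [(0, 0)]
  | (e :: es) :: D => fullBox D ++ [(e.1, lastCoord e.1 es)]

theorem length_fullBox : ∀ D : List (List Entry), (fullBox D).length = D.length
  | [] => rfl
  | [] :: D => by simp [fullBox, length_fullBox D]
  | (e :: es) :: D => by simp [fullBox, length_fullBox D]

theorem cellSum_add (c : List (ℝ × ℝ)) (f g : ℝ → ℝ) :
    cellSum c (fun a => f a + g a) = cellSum c f + cellSum c g := by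
  simp [cellSum, mul_add, List.sum_map_add]

theorem sideSum_add (S : List Entry) (f g : ℝ → ℝ) :
    sideSum S (fun a => f a + g a) = sideSum S f + sideSum S g := by
  cases S with
  | nil => simp [sideSum]
  | cons e es => exact cellSum_add _ _ _

theorem gridSum_add (D : List (List Entry)) (f g : List ℝ → ℝ) :
    gridSum D (fun a => f a + g a) = gridSum D f + gridSum D g := by
  induction D generalizing f g with
  | nil => rfl
  | cons S D ih => simp only [gridSum, sideSum_add, ih]

theorem gridSum_zero (D : List (List Entry)) : gridSum D (fun _ => 0) = 0 := by
  simpa using gridSum_add D (fun _ => 0) fun _ => 0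

theorem gridSum_cellSum_flatten (D : List (List Entry)) (cs : List (List (ℝ × ℝ)))
    (g : List ℝ → ℝ → ℝ) :
    gridSum D (fun p => cellSum cs.flatten (g p)) =
      (cs.map fun c => gridSum D fun p => cellSum c (g p)).sum := by
  induction cs with
  | nil => simp [cellSum, gridSum_zero]
  | cons c cs ih =>
    rw [List.map_cons, List.sum_cons, ← ih, ← gridSum_add]
    simp [cellSum]

/-- A box that meets the product partially either has an end of its first side strictly between `x`
and `z` or meets `bx` partially with its other sides. Thus each dimension adds at most the number of
ends inside a chunk. -/
theorem countP_innerSide_le {B : List Sides} (hB : ∀ b ∈ B, b ≠ []) (bx : Sides) (x z : ℝ) :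
    B.countP (fun b => 2 ≤ relBox b ((x, z) :: bx)) ≤
      (entriesOf B).countP (fun e => x < e.1 ∧ e.1 < z) +
      (tailsOf B).countP fun b => 2 ≤ relBox b bx := by
  induction B with
  | nil => simp
  | cons b B ih =>
    have ih := ih fun b hb => hB b (List.mem_cons_of_mem _ hb)
    cases b with
    | nil => simp at hB
    | cons p t =>
      simp only [entriesOf, tailsOf, List.countP_cons]
      by_cases h : 2 ≤ relBox t bx
      · simp only [h]
        split_ifs <;> simp_all <;> omega
      · by_cases h' : 2 ≤ relSide p (x, z)
        · obtain hi | hi := inner_of_relSide h'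
          · simp only at hi
            simp only [hi, and_self, decide_true, if_true]
            split_ifs <;> omega
          · simp only at hi
            simp only [hi, and_self, decide_true, if_true]
            split_ifs <;> omega
        · have : ¬ 2 ≤ relBox (p :: t) ((x, z) :: bx) := by
            simp only [relBox]
            nlinarith
          simp only [this, decide_false, Bool.false_eq_true, if_false]
          omega

theorem countP_entriesOf {B : List Sides} (hB : ∀ b ∈ B, b ≠ []) (bx : Sides) :
    (entriesOf B).countP (fun e => 2 ≤ relBox e.2 bx) =
      2 * (tailsOf B).countP fun b => 2 ≤ relBox b bx := by
  induction B with
  | nil => simp [entriesOf, tailsOf]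
  | cons b B ih =>
    have ih := ih fun b hb => hB b (List.mem_cons_of_mem _ hb)
    cases b with
    | nil => simp at hB
    | cons p t =>
      simp only [entriesOf, tailsOf, List.countP_cons, ih]
      split_ifs <;> omega

theorem mem_entriesOf {B : List Sides} (hB : ∀ b ∈ B, b ≠ []) {e : Entry} :
    e ∈ entriesOf B ↔ ∃ p t, p :: t ∈ B ∧ (e = (p.1, t) ∨ e = (p.2, t)) := by
  induction B with
  | nil => simp [entriesOf]
  | cons b B ih =>
    have ih := ih fun b hb => hB b (List.mem_cons_of_mem _ hb)
    cases b with
    | nil => simp at hB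
    | cons p t =>
      simp only [entriesOf, List.mem_cons, ih]
      constructor
      · rintro (h | h | ⟨q, s, hq, h⟩)
        · exact ⟨p, t, .inl rfl, .inl h⟩
        · exact ⟨p, t, .inl rfl, .inr h⟩
        · exact ⟨q, s, .inr hq, h⟩
      · rintro ⟨q, s, hq | hq, h⟩
        · cases hq
          exact h.elim .inl fun h => .inr (.inl h)
        · exact .inr (.inr ⟨q, s, hq, h⟩)

theorem mem_tailsOf {B : List Sides} (hB : ∀ b ∈ B, b ≠ []) {t : Sides} :
    t ∈ tailsOf B ↔ ∃ p, p :: t ∈ B := by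
  rw [tailsOf_eq_map hB, List.mem_map]
  constructor
  · rintro ⟨b, hb, rfl⟩
    cases b with
    | nil => simpa using hB _ hb
    | cons p t => exact ⟨p, hb⟩
  · rintro ⟨p, hp⟩
    exact ⟨_, hp, rfl⟩

/-- A tree for a product of chunks of the last dimensions. The list `B` consists of the sides of all
boxes in these dimensions. -/
structure IsPartialTree (B : List Sides) (M h e : ℕ) (v : WTree) : Prop where
  length_box : v.box.length = e
  wellFormed : v.WellFormed
  countP_le : B.countP (fun b => 2 ≤ relBox b v.box) ≤ e * M
  good : ∀ b ∈ B, v.Good b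
  crossings_le : ∀ i a, v.crossings i a ≤ h + e

/-- Both properties of chunks are used here. Few ends in the interior means that at most `M` further
boxes become partial; special ends at the boundary mean that a box which cuts the later dimensions
does not cut the new one. -/
theorem IsPartialTree.times {B : List Sides} {M h e : ℕ} {v : WTree}
    (hv : IsPartialTree (tailsOf B) M h e v) (hB : ∀ b ∈ B, b ≠ []) {S : List Entry}
    (hS : S.Perm (entriesOf B)) {x z : ℝ} {c : List (ℝ × ℝ)} (hc : IsChunk v.box M S x c z)
    {T : WTree} (hT : T.box = [(x, z)]) (hTw : T.WellFormed)
    (hTc : ∀ a, T.crossings 0 a ≤ h)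
    (hTg : ∀ p : ℝ × ℝ, (∀ r ∈ c, relSide p r ≤ 1) → T.Good [p]) :
    IsPartialTree B M h (e + 1) (T.times v) := by
  have hbox : (T.times v).box = (x, z) :: v.box := by simp [WTree.times, hT]
  refine ⟨by simp [hbox, hv.length_box], ⟨hTw, hv.wellFormed, ⟨(x, z), hT, ?_⟩, by ring⟩, ?_, ?_, ?_⟩
  · simp [hT]
  · rw [hbox]
    refine (countP_innerSide_le hB v.box x z).trans ?_
    have := hc.countP_le
    rw [hS.countP_eq] at this
    have := hv.countP_le
    rw [add_mul]
    omega
  · intro b hb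
    cases b with
    | nil => exact absurd rfl (hB _ hb)
    | cons p t =>
      have h₁ : (p.1, t) ∈ S := hS.mem_iff.2 ((mem_entriesOf hB).2 ⟨p, t, hb, .inl rfl⟩)
      have h₂ : (p.2, t) ∈ S := hS.mem_iff.2 ((mem_entriesOf hB).2 ⟨p, t, hb, .inr rfl⟩)
      refine ⟨hTg p fun r hr => relSide_le_one (hc.cell r hr _ h₁) (hc.cell r hr _ h₂),
        hv.good t ((mem_tailsOf hB).2 ⟨p, hb⟩), ?_⟩
      have hbx : (T.box.take 1 ++ v.box) = (x, z) :: v.box := by simp [hT]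
      rw [hbx, hT]
      simp only [relBox, mul_one]
      obtain h | h | h : relBox t v.box = 0 ∨ relBox t v.box = 1 ∨ 2 ≤ relBox t v.box := by omega
      · simp [h]
      · simp [h]
      -- The remaining sides cut the region, so both ends of `p` are special and lie outside the
      -- open chunk; hence `p` does not cut the chunk.
      · have : relSide p (x, z) ≤ 1 := relSide_le_one (hc.special _ h₁ h) (hc.special _ h₂ h)
        obtain h' | h' : relSide p (x, z) = 0 ∨ relSide p (x, z) = 1 := by omega
        · simp [h']
        · simp [h']
  · intro i a
    have := innerCount_le_one (T.box.take 1 ++ v.box) i a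
    cases i with
    | zero =>
      have := hTc a
      simp only [WTree.times, crossings]
      omega
    | succ i =>
      have := hv.crossings_le i a
      simp only [WTree.times, crossings]
      omega

/-- `Q` pays for dividing one region and joining the results, and `K` bounds the number of chunks,
each of which needs a construction in one dimension fewer. -/
def buildTime (Q K : ℕ) : ℕ → ℕ
  | 0 => 20
  | j + 1 => Q + K * buildTime Q K j

/-- The tree `v` that is built from the partial tree `cell` for the remaining dimensions `D`. -/
structure IsBuilt (B₀ : List Sides) (A K : ℕ) (D : List (List Entry)) (cell v : WTree) : Prop where
  box_eq : v.box = fullBox D ++ cell.box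
  wellFormed : v.WellFormed
  good : ∀ b ∈ B₀, v.Good b
  integral_eq : ∀ f, v.integral f = gridSum D fun p => cell.integral fun q => f (p ++ q)
  crossings_done : ∀ i, D.length ≤ i → ∀ a, v.crossings i a + 1 ≤ K ^ D.length * (A + 1)
  crossings_pending : ∀ i < D.length, ∀ a,
    v.crossings i a + 1 ≤ 2 * (K ^ (D.length - 1) * (A + 1))

theorem SortedDims.length_eq {B₀ B : List Sides} {D : List (List Entry)} (h : SortedDims B₀ D B) :
    B.length = B₀.length := by
  induction h with
  | nil => rfl
  | cons h hB hl hp ih => rw [tailsOf_eq_map hB, List.length_map, ih]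

theorem SortedDims.length_le {B₀ B : List Sides} {D : List (List Entry)} (h : SortedDims B₀ D B)
    {d : ℕ} (hd : ∀ b ∈ B₀, b.length ≤ d) : ∀ b ∈ B, b.length ≤ d := by
  induction h with
  | nil => exact hd
  | cons h hB hl hp ih =>
    intro b hb
    obtain ⟨p, hp⟩ := (mem_tailsOf hB).1 hb
    have := ih _ hp
    simp only [List.length_cons] at this
    omega

/-- The construction and the loop over the chunks call each other. Here the induction runs over the
chunks, with the construction in one dimension fewer as the hypothesis `hbuild`, which is discharged
in `exists_build`. -/
theorem calls_children {B₀ B : List Sides} {M K h e A T : ℕ} {cell : WTree}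
    {D : List (List Entry)} (hB : ∀ b ∈ B, b ≠ []) {S : List Entry} (hS : S.Perm (entriesOf B))
    (hcell : IsPartialTree (tailsOf B) M h e cell) (hM : Nat.clog 2 M ≤ h)
    (hbuild : ∀ v, IsPartialTree B M h (e + 1) v → ∃ w,
      Calls buildFn (.cons v.encode (.cons (encodeDims D) (.num M))) w.encode T ∧
      IsBuilt B₀ A K D v w) (cs : List (List (ℝ × ℝ))) {x y : ℝ}
    (hcs : ConsecChunks cell.box M S x cs y) :
    ∃ vs : List WTree, Calls childrenFn (.cons (encodeChunks cs) (.cons cell.encode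
        (.cons (encodeDims D) (.num M)))) (encodeList (vs.map WTree.encode))
        (cs.length * (T + 150) + 500 * cs.flatten.length + 10) ∧
      vs.length = cs.length ∧ ConsecBoxes (fullBox D) cell.box x vs y ∧
      (∀ v ∈ vs, ∃ c, IsBuilt B₀ A K D c v ∧ IsPartialTree B M h (e + 1) c) ∧
      ∀ f, (vs.map fun v => v.integral f).sum = (cs.map fun c => gridSum D fun p =>
        cellSum c fun a => cell.integral fun q => f (p ++ [a] ++ q)).sum := by
  induction cs generalizing x with
  | nil =>
    exact ⟨[], .of_wp childrenBody rfl (by simp [childrenBody, wp, Yields]), rfl, hcs, by simp,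
      by simp⟩
  | cons c cs ih =>
    obtain ⟨z, hc, hcs⟩ := hcs
    obtain ⟨vs, hvs, hl, hb, hp, hi⟩ := ih hcs
    obtain ⟨t, ⟨u, w, h₁, h₂, h₃⟩, tb, tw, ti, tc, tg⟩ := exists_chunkTree hc
    have hpt := hcell.times hB hS hc tb tw (fun a => (tc a).trans hM) tg
    obtain ⟨v, hv, hbt⟩ := hbuild _ hpt
    refine ⟨v :: vs, .of_wp childrenBody rfl ?_, by simp [hl], ⟨z, ?_, hc.consec.le, hb⟩, ?_, ?_⟩
    · simp [childrenBody, wp]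
      refine ⟨_, _, h₁, _, _, h₂, _, _, h₃, _, _, calls_times _ _, _, _, hv, _, _, hvs, ?_⟩
      simp [Yields]
      rw [add_mul]
      simp at *
      omega
    · rw [hbt.box_eq]
      simp [WTree.times, tb]
    · simp only [List.mem_cons, forall_eq_or_imp]
      exact ⟨⟨_, hbt, hpt⟩, hp⟩
    · intro f
      rw [List.map_cons, List.sum_cons, hi f, List.map_cons, List.sum_cons, hbt.integral_eq]
      congr 2
      ext p
      simp only [WTree.times, WTree.integral, one_mul, ti, List.append_assoc]

/-- Induction on the dimensions still to be divided. With none left the partial tree itself is the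
result. Otherwise at most `K` chunks are extended to partial trees, completed recursively and joined
by a balanced tree. -/
theorem exists_build {B₀ B : List Sides} {d M K n : ℕ} (hd : ∀ b ∈ B₀, b.length ≤ d)
    (hn : B₀.length = n) (hn0 : n ≠ 0) (hnM : n ≤ M * M) (hM : 0 < M)
    (hK : 1 + 2 * d * M + 2 * M ≤ K) {D : List (List Entry)} (h : SortedDims B₀ D B) {e : ℕ}
    (he : D.length + e = d) {cell : WTree}
    (hcell : IsPartialTree B M (Nat.clog 2 K) e cell) :
    ∃ v, Calls buildFn (.cons cell.encode (.cons (encodeDims D) (.num M))) v.encode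
        (buildTime ((100 * d + 1300) * n + (80 * d + 530) * K + 130) K D.length) ∧
      IsBuilt B₀ (Nat.clog 2 K + d) K D cell v := by
  induction h generalizing e cell with
  | nil =>
    refine ⟨cell, .of_wp buildBody rfl ?_, by simp [fullBox], hcell.wellFormed, hcell.good,
      by simp [gridSum], ?_, by simp⟩
    · simp [buildBody, wp, Yields, buildTime]
    · intro i _ a
      have := hcell.crossings_le i a
      simp at he ⊢
      omega
  | @cons D B S h hB hs hp ih =>
    have hlen := h.length_eq
    have hSl := hp.length_eq
    rw [length_entriesOf hB, hlen, hn] at hSl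
    have hKM : M ≤ K := by omega
    have hbuild := fun v hv => ih (e := e + 1) (by simp at he; omega) (cell := v) hv
    match S, hs, hp, hSl, he with
    -- There are `2 * n` ends and `n` is not 0, so at least two ends exist.
    | [], _, _, hSl, _ => simp at hSl; omega
    | [_], _, _, hSl, _ => simp at hSl; omega
    | e₀ :: e₁ :: es, hs, hp, hSl, he =>
    obtain ⟨c, cs, z, hcs, hc, hcc, -⟩ := exists_consecChunks (bx := cell.box) hs hM
      (List.cons_ne_nil _ _)
    have hchunks : ConsecChunks cell.box M (e₀ :: e₁ :: es) e₀.1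
        (chunks cell.box M e₀.1 (e₁ :: es) 0) (lastCoord e₀.1 (e₁ :: es)) := by
      rw [hcs]
      exact ⟨z, hc, hcc⟩
    have hne : chunks cell.box M e₀.1 (e₁ :: es) 0 ≠ [] := by simp [hcs]
    have hflat := flatten_chunks cell.box M e₀.1 (e₁ :: es) 0
    have hcount := mul_length_chunks_le cell.box M e₀.1 (e₁ :: es) 0
    have hcall := calls_chunk (k := d) cell.box M e₀.1 (e₁ :: es) (by
      intro a ha
      have ha : a ∈ e₀ :: e₁ :: es := List.mem_cons_of_mem _ ha
      obtain ⟨p, t, hpt, hat⟩ := (mem_entriesOf hB).1 (hp.mem_iff.1 ha)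
      have := h.length_le hd _ hpt
      simp only [List.length_cons] at this
      obtain rfl | rfl := hat <;> simp only <;> omega) 0
    have hsp : (e₁ :: es).countP (fun e => decide (2 ≤ relBox e.2 cell.box)) ≤ 2 * (e * M) := by
      have h₁ := hcell.countP_le
      have h₂ := countP_entriesOf hB cell.box
      rw [← hp.countP_eq] at h₂
      have h₃ : (e₁ :: es).countP (fun e => decide (2 ≤ relBox e.2 cell.box)) ≤
        (e₀ :: e₁ :: es).countP fun e => decide (2 ≤ relBox e.2 cell.box) :=
        (List.sublist_cons_self _ _).countP_le
      omega
    clear hcs hcc hc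
    generalize hchk : chunks cell.box M e₀.1 (e₁ :: es) 0 = chk at *
    -- Full chunks: fewer than `2 * n ≤ 2 * M * M` intervals give at most `2 * M`. Special cuts: at
    -- most `e * M ≤ d * M` partial boxes with two ends each. The comparison is made after
    -- multiplying by `M`.
    have hchkK : chk.length ≤ K := by
      have hes : (e₁ :: es).length + 1 = 2 * n := by simpa using hSl
      have hed : e ≤ d := by omega
      have h₁ : M * chk.length ≤ M * (1 + 2 * (d * M)) + 2 * (M * M) := by
        refine hcount.trans ?_
        have : M * (1 + (e₁ :: es).countP fun e => decide (2 ≤ relBox e.2 cell.box)) ≤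
            M * (1 + 2 * (d * M)) := by
          gcongr
          exact hsp.trans (by gcongr)
        omega
      have h₂ : M * chk.length ≤ M * K := by
        refine h₁.trans (le_trans (le_of_eq ?_) (Nat.mul_le_mul_left M hK))
        ring
      exact Nat.le_of_mul_le_mul_left h₂ hM
    obtain ⟨vs, hvs, hvl, hvb, hvp, hvi⟩ := calls_children hB hp hcell
      (Nat.clog_mono_right 2 hKM) hbuild chk hchunks
    have hvne : vs ≠ [] := by
      rw [← List.length_pos_iff, hvl]
      exact List.length_pos_iff.2 hne
    obtain ⟨t, ht, htd, u, hw, hl⟩ := exists_balanced WTree.encode vs hvne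
    rw [← ht] at hvb
    have hwf : ∀ v ∈ t.flatten, v.WellFormed := by
      rw [ht]
      intro v hv
      obtain ⟨c, hc, -⟩ := hvp v hv
      exact hc.wellFormed
    have hbl : ∀ v ∈ t.flatten, v.box.length ≤ d := by
      rw [ht]
      intro v hv
      obtain ⟨c, hc, hc'⟩ := hvp v hv
      rw [hc.box_eq, List.length_append, length_fullBox, hc'.length_box]
      simp at he
      omega
    have hfold := (calls_fold t hbl).1
    have hsize := t.size_add_one
    rw [ht, hvl] at hsize
    have hdepth : t.depth ≤ Nat.clog 2 K :=
      htd.trans (Nat.clog_mono_right 2 (by omega))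
    refine ⟨t.fold, .of_wp buildBody rfl ?_, ?_, wellFormed_fold t hvb hwf, ?_, ?_, ?_, ?_⟩
    · obtain ⟨rest, hrest⟩ := cell.exists_encode_eq
      rw [hrest] at hvs
      simp only [encodeEntries_cons] at hcall
      simp [buildBody, wp, encodeEntry, hrest]
      simp [encodeEntry] at hcall
      refine ⟨_, _, hcall, _, _, hvs, _, _, hw, _, _, hl, _, _, hfold, ?_⟩
      simp only [Yields, true_and]
      have hes : es.length + 1 + 1 = 2 * n := by simpa using hSl
      have e₁ : (50 * d + 150) * (es.length + 1) ≤ (50 * d + 150) * (2 * n) := by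
        gcongr; omega
      have e₂ : (40 * d + 100) * t.size ≤ (40 * d + 100) * (2 * K) := by
        gcongr; omega
      have e₃ : ∀ T, chk.length * (T + 150) ≤ K * T + K * 150 := fun T => by
        rw [← mul_add]; gcongr
      have e₃ := e₃ (buildTime ((100 * d + 1300) * n + (80 * d + 530) * K + 130) K D.length)
      rw [hflat, length_intervals, hvl]
      simp only [buildTime, List.length_cons]
      have e₄ : (100 * d + 1300) * n + (80 * d + 530) * K =
        (50 * d + 150) * (2 * n) + 1000 * n + ((40 * d + 100) * (2 * K) + 330 * K) := by ring
      omega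
    · rw [(box_fold t hvb).1]
      simp [fullBox]
    · intro b hb
      refine good_fold t ?_
      rw [ht]
      intro v hv
      obtain ⟨c, hc, -⟩ := hvp v hv
      exact hc.good b hb
    · intro f
      rw [integral_fold, ht, hvi f, ← gridSum_cellSum_flatten, hflat]
      rfl
    -- In a dimension that was chunked before, `a` may cross all of the at most `K` subtrees.
    · intro i hi a
      have hX : ∀ v ∈ t.flatten, v.crossings i a ≤
          K ^ D.length * (Nat.clog 2 K + d + 1) - 1 := by
        rw [ht]
        intro v hv
        obtain ⟨c, hc, -⟩ := hvp v hv
        have := hc.crossings_done i (by simp at hi; omega) a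
        omega
      refine (crossings_fold_add_one_le t hX).trans ?_
      have h1 : 1 ≤ K ^ D.length * (Nat.clog 2 K + d + 1) :=
        Nat.mul_pos (pow_pos (by omega) _) (by omega)
      rw [Nat.sub_add_cancel h1, List.length_cons, pow_succ', mul_assoc, ht, hvl]
      gcongr
    · intro i hi a
      have h1 : 1 ≤ K ^ D.length * (Nat.clog 2 K + d + 1) :=
        Nat.mul_pos (pow_pos (by omega) _) (by omega)
      simp only [List.length_cons, Nat.add_sub_cancel] at hi ⊢
      -- First the dimension divided at this level: one path and one subtree, for which this
      -- dimension already counts as done. The length of the path is absorbed by the factor 2. In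
      -- earlier dimensions all subtrees may be crossed, which costs another factor `K`.
      obtain rfl | hi := Nat.eq_or_lt_of_le (Nat.le_of_lt_succ hi)
      · have hX : ∀ v ∈ t.flatten, v.crossings (fullBox D).length a ≤
            K ^ D.length * (Nat.clog 2 K + d + 1) - 1 := by
          rw [ht]
          intro v hv
          obtain ⟨c, hc, -⟩ := hvp v hv
          have := hc.crossings_done (fullBox D).length (by rw [length_fullBox]) a
          omega
        have := crossings_fold_le t hvb hwf hX
        rw [length_fullBox] at this
        have h2 : Nat.clog 2 K + d + 1 ≤ K ^ D.length * (Nat.clog 2 K + d + 1) :=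
          Nat.le_mul_of_pos_left _ (pow_pos (by omega) _)
        omega
      · have hX : ∀ v ∈ t.flatten, v.crossings i a ≤
            2 * (K ^ (D.length - 1) * (Nat.clog 2 K + d + 1)) - 1 := by
          rw [ht]
          intro v hv
          obtain ⟨c, hc, -⟩ := hvp v hv
          have := hc.crossings_pending i hi a
          omega
        refine (crossings_fold_add_one_le t hX).trans ?_
        have h1 : 1 ≤ K ^ (D.length - 1) * (Nat.clog 2 K + d + 1) :=
          Nat.mul_pos (pow_pos (by omega) _) (by omega)
        rw [Nat.sub_add_cancel (by omega), ht, hvl]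
        have : K ^ D.length = K * K ^ (D.length - 1) := by
          rw [← pow_succ', Nat.sub_add_cancel (by omega)]
        rw [this]
        calc _ ≤ K * (2 * (K ^ (D.length - 1) * (Nat.clog 2 K + d + 1))) := by gcongr
          _ = _ := by ring

open BinTree WTree

/-! ### The grid -/

/-- The middle points of the intervals between consecutive points of `G`. -/
def gapCenters (G : Set ℝ) : Set ℝ :=
  {c | ∃ l ∈ G, ∃ u ∈ G, l < u ∧ (∀ x ∈ G, x ≤ l ∨ u ≤ x) ∧ c = (l + u) / 2}

theorem gapCenters_finite {G : Set ℝ} (hG : G.Finite) : (gapCenters G).Finite := by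
  refine ((hG.prod hG).image fun q : ℝ × ℝ => (q.1 + q.2) / 2).subset ?_
  rintro c ⟨l, hl, u, hu, -, -, rfl⟩
  exact ⟨(l, u), ⟨hl, hu⟩, rfl⟩

/-- Repeated ends give degenerate intervals, which count 0. The others are exactly the gaps between
consecutive distinct ends, and their centers are distinct, so the list sum is a sum over a finite
set. -/
theorem exists_cellSum_eq {e : Entry} {es : List Entry} (hs : SortedEntries (e :: es)) :
    ∃ s : Finset ℝ, (∀ c, c ∈ s ↔ c ∈ gapCenters {x | ∃ a ∈ e :: es, x = a.1}) ∧
      ∀ g, cellSum (intervals e.1 es) g = ∑ c ∈ s, g c := by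
  classical
  induction es generalizing e with
  | nil =>
    refine ⟨∅, fun c => ?_, fun g => rfl⟩
    simp only [Finset.notMem_empty, false_iff]
    rintro ⟨l, ⟨a, ha, rfl⟩, u, ⟨b, hb, rfl⟩, h, -⟩
    simp only [List.mem_singleton] at ha hb
    subst ha hb
    exact lt_irrefl _ h
  | cons e₁ es ih =>
    simp only [SortedEntries, List.pairwise_cons] at hs
    obtain ⟨h₀, h₁⟩ := hs
    obtain ⟨s, hs, hg⟩ := ih (List.pairwise_cons.2 h₁)
    have he := h₀ e₁ (by simp)
    have hmin : ∀ a ∈ e₁ :: es, e₁.1 ≤ a.1 := by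
      simp only [List.mem_cons, forall_eq_or_imp]
      exact ⟨le_rfl, h₁.1⟩
    by_cases h : e₁.1 ≤ e.1
    · refine ⟨s, fun c => ?_, fun g => ?_⟩
      · rw [hs]
        have : {x | ∃ a ∈ e₁ :: es, x = a.1} = {x | ∃ a ∈ e :: e₁ :: es, x = a.1} := by
          ext x
          constructor
          · rintro ⟨a, ha, rfl⟩
            exact ⟨a, List.mem_cons_of_mem _ ha, rfl⟩
          · rintro ⟨a, ha, rfl⟩
            obtain rfl | ha := List.mem_cons.1 ha
            · exact ⟨e₁, by simp, le_antisymm he h⟩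
            · exact ⟨a, ha, rfl⟩
        rw [this]
      · rw [← hg]
        simp [intervals, cellSum, cellCount, h]
    · push Not at h
      have hlt : ∀ c ∈ s, e₁.1 < c := by
        intro c hc
        obtain ⟨l, ⟨a, ha, rfl⟩, u, ⟨b, hb, rfl⟩, hab, -, rfl⟩ := (hs c).1 hc
        linarith [hmin a ha]
      refine ⟨insert ((e.1 + e₁.1) / 2) s, fun c => ?_, fun g => ?_⟩
      · rw [Finset.mem_insert, hs]
        constructor
        · rintro (rfl | ⟨l, ⟨a, ha, rfl⟩, u, ⟨b, hb, rfl⟩, hab, hgap, rfl⟩)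
          · refine ⟨_, ⟨e, by simp, rfl⟩, _, ⟨e₁, by simp, rfl⟩, h, ?_, rfl⟩
            rintro x ⟨a, ha, rfl⟩
            obtain rfl | ha := List.mem_cons.1 ha
            · exact .inl le_rfl
            · exact .inr (hmin a ha)
          · refine ⟨_, ⟨a, List.mem_cons_of_mem _ ha, rfl⟩, _, ⟨b, List.mem_cons_of_mem _ hb, rfl⟩,
              hab, ?_, rfl⟩
            rintro x ⟨y, hy, rfl⟩
            obtain rfl | hy := List.mem_cons.1 hy
            · exact .inl (h.le.trans (hmin a ha))
            · exact hgap _ ⟨y, hy, rfl⟩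
        · rintro ⟨l, ⟨a, ha, rfl⟩, u, ⟨b, hb, rfl⟩, hab, hgap, rfl⟩
          have hb' : b ∈ e₁ :: es := by
            obtain rfl | hb := List.mem_cons.1 hb
            · obtain rfl | ha := List.mem_cons.1 ha
              · exact absurd hab (lt_irrefl _)
              · linarith [h₀ a ha]
            · exact hb
          obtain rfl | ha := List.mem_cons.1 ha
          · left
            obtain h' | h' := hgap _ ⟨e₁, by simp, rfl⟩
            · linarith
            · rw [le_antisymm h' (hmin b hb')]
          · right
            exact ⟨_, ⟨a, ha, rfl⟩, _, ⟨b, hb', rfl⟩, hab,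
              fun x ⟨y, hy, hx⟩ => hgap x ⟨y, List.mem_cons_of_mem _ hy, hx⟩, rfl⟩
      · have hn : (e.1 + e₁.1) / 2 ∉ s := fun hc => by linarith [hlt _ hc]
        rw [Finset.sum_insert hn, ← hg]
        simp [intervals, cellSum, cellCount, not_le.2 h]

/-- The ends of the sides of the boxes in dimension `i`. -/
def sideEnds (B₀ : List Sides) (i : ℕ) : Set ℝ :=
  {x | ∃ b ∈ B₀, ∃ r : ℝ × ℝ, b[i]? = some r ∧ (x = r.1 ∨ x = r.2)}

theorem sideEnds_finite (B₀ : List Sides) (i : ℕ) : (sideEnds B₀ i).Finite := by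
  have h : {r | r ∈ B₀.flatten}.Finite := List.finite_toSet _
  refine ((h.image Prod.fst).union (h.image Prod.snd)).subset ?_
  rintro x ⟨b, hb, r, hr, hx⟩
  have hm : r ∈ B₀.flatten := List.mem_flatten.2 ⟨b, hb, List.mem_of_getElem? hr⟩
  obtain rfl | rfl := hx
  · exact .inl ⟨r, hm, rfl⟩
  · exact .inr ⟨r, hm, rfl⟩

noncomputable def gridCenters (B₀ : List Sides) (i : ℕ) : Finset ℝ :=
  (gapCenters_finite (sideEnds_finite B₀ i)).toFinset

theorem SortedDims.eq_map_drop {B₀ B : List Sides} {D : List (List Entry)}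
    (h : SortedDims B₀ D B) : B = B₀.map fun b => b.drop D.length := by
  induction h with
  | nil => simp
  | cons h hB hl hp ih =>
    rw [tailsOf_eq_map hB]
    subst ih
    simp

theorem sum_piFinset_snoc (s : ℕ → Finset ℝ) (n : ℕ) (f : List ℝ → ℝ) :
    ∑ p ∈ Fintype.piFinset fun i : Fin n => s i, ∑ a ∈ s n, f (List.ofFn p ++ [a]) =
      ∑ p ∈ Fintype.piFinset fun i : Fin (n + 1) => s i, f (List.ofFn p) := by
  rw [← Finset.sum_product']
  refine Finset.sum_nbij' (fun q => Fin.snoc (α := fun _ => ℝ) q.1 q.2)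
    (fun p => (fun i => p i.castSucc, p (Fin.last n))) ?_ ?_ ?_ ?_ ?_
  · simp only [Finset.mem_product, Fintype.mem_piFinset]
    rintro ⟨p, a⟩ ⟨hp, ha⟩ i
    refine Fin.lastCases ?_ (fun i => ?_) i
    · simpa using ha
    · simpa using hp i
  · simp only [Finset.mem_product, Fintype.mem_piFinset]
    intro p hp
    exact ⟨fun i => by simpa using hp i.castSucc, by simpa using hp (Fin.last n)⟩
  · simp
  · intro p _
    ext i
    refine Fin.lastCases ?_ (fun i => ?_) i <;> simp
  · rintro ⟨p, a⟩ _
    rw [List.ofFn_succ']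
    simp

theorem gridSum_eq {B₀ B : List Sides} {D : List (List Entry)} (h : SortedDims B₀ D B)
    (hne : B₀ ≠ []) (f : List ℝ → ℝ) :
    gridSum D f =
      ∑ p ∈ Fintype.piFinset fun i : Fin D.length => gridCenters B₀ i, f (List.ofFn p) := by
  induction h generalizing f with
  | nil => simp [gridSum]
  | @cons D B S h hB hs hp ih =>
    rw [gridSum, ih, List.length_cons, ← sum_piFinset_snoc]
    refine Finset.sum_congr rfl fun p _ => ?_
    have hlen := hp.length_eq
    rw [length_entriesOf hB, h.length_eq] at hlen
    have := List.length_pos_iff.2 hne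
    cases S with
    | nil => rw [List.length_nil] at hlen; omega
    | cons e es =>
      obtain ⟨s, hs, hg⟩ := exists_cellSum_eq hs
      rw [sideSum, hg]
      -- `D.length` dimensions have been dropped before `S` was formed, so the first side of what
      -- remains has that index in the original box.
      have hse : {x | ∃ a ∈ e :: es, x = a.1} = sideEnds B₀ D.length := by
        have hB' := h.eq_map_drop
        ext x
        constructor
        · rintro ⟨a, ha, rfl⟩
          obtain ⟨q, t, hq, hat⟩ := (mem_entriesOf hB).1 (hp.mem_iff.1 ha)
          rw [hB'] at hq
          obtain ⟨b, hb, hbq⟩ := List.mem_map.1 hq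
          refine ⟨b, hb, q, ?_, ?_⟩
          · have := List.getElem?_drop (xs := b) (i := D.length) (j := 0)
            rw [hbq] at this
            simpa using this.symm
          · obtain rfl | rfl := hat <;> simp
        · rintro ⟨b, hb, q, hq, hx⟩
          have hm : q :: b.drop (D.length + 1) ∈ B := by
            rw [hB']
            refine List.mem_map.2 ⟨b, hb, ?_⟩
            obtain ⟨hlt, rfl⟩ := List.getElem?_eq_some_iff.1 hq
            exact List.drop_eq_getElem_cons hlt
          obtain rfl | rfl := hx
          · exact ⟨_, hp.mem_iff.2 ((mem_entriesOf hB).2 ⟨q, _, hm, .inl rfl⟩), rfl⟩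
          · exact ⟨_, hp.mem_iff.2 ((mem_entriesOf hB).2 ⟨q, _, hm, .inr rfl⟩), rfl⟩
      have : s = gridCenters B₀ D.length := by
        ext c
        rw [hs, hse, gridCenters, Set.Finite.mem_toFinset]
      rw [this]

/-! ### The weight index -/

/-- The sides of a box. -/
def boxSides {d : ℕ} (b : Box (Fin d)) : Sides := List.ofFn fun i => (b.lower i, b.upper i)

theorem encodeBox_eq {d : ℕ} (b : Box (Fin d)) : encodeBox b = encodeSides (boxSides b) := by
  simp [encodeBox, encodeSides, boxSides, List.map_ofFn, Function.comp_def, encodeSide]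

theorem encodeBoxes_eq {d : ℕ} (B : List (Box (Fin d))) :
    encodeBoxes B = encodeBoxList (B.map boxSides) := by
  rw [encodeBoxes, encodeBoxList, List.map_map]
  congr 1
  exact List.map_congr_left fun b _ => encodeBox_eq b

theorem sideEnds_map_boxSides {d : ℕ} (B : List (Box (Fin d))) (i : Fin d) :
    sideEnds (B.map boxSides) i = gridCoords B i := by
  ext x
  simp [sideEnds, gridCoords, boxSides]

theorem inClosed_boxSides {d : ℕ} (b : Box (Fin d)) (p : Fin d → ℝ) :
    InClosed (List.ofFn p) (boxSides b) ↔ p ∈ Box.Icc b := by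
  rw [InClosed, boxSides, List.forall₂_iff_get, Box.Icc_def, Set.mem_Icc, Pi.le_def, Pi.le_def]
  simp only [List.length_ofFn, true_and, List.get_eq_getElem, List.getElem_ofFn]
  constructor
  · intro h
    exact ⟨fun i => (h i i.2 i.2).1, fun i => (h i i.2 i.2).2⟩
  · intro h i hi _
    exact ⟨h.1 ⟨i, hi⟩, h.2 ⟨i, hi⟩⟩

/-- The facets of `b` belong to the grid, so a grid cell with its center in `b` lies entirely in `b`
and is covered. This is why uncovered cells in the tree do no harm. -/
theorem mem_discretization_iff {d : ℕ} (B : List (Box (Fin d))) {b : Box (Fin d)} (hb : b ∈ B)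
    {p : Fin d → ℝ} (hp : p ∈ Box.Icc b) : p ∈ discretization B ↔
      p ∈ Fintype.piFinset fun i : Fin d => gridCenters (B.map boxSides) i := by
  simp only [discretization, Set.Finite.mem_toFinset, Fintype.mem_piFinset, gridCenters,
    sideEnds_map_boxSides]
  constructor
  · rintro ⟨c, hc, -, rfl⟩ i
    exact ⟨_, (hc i).1, _, (hc i).2.1, c.lower_lt_upper i, (hc i).2.2, rfl⟩
  · intro h
    choose l hl u hu hlu hgap hpc using h
    refine ⟨⟨l, u, hlu⟩, fun i => ⟨hl i, hu i, hgap i⟩, ⟨b, hb, ?_⟩, funext hpc⟩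
    rw [Box.Icc_def, Set.mem_Icc, Pi.le_def, Pi.le_def] at hp
    rw [Box.Icc_def, Box.Icc_def]
    refine Set.Icc_subset_Icc (fun i => ?_) fun i => ?_
    · refine (hgap i (b.lower i) ⟨b, hb, .inl rfl⟩).resolve_right fun h => ?_
      have h₁ := hp.1 i
      have h₂ := hpc i
      have h₃ := hlu i
      linarith
    · refine (hgap i (b.upper i) ⟨b, hb, .inr rfl⟩).resolve_left fun h => ?_
      have h₁ := hp.2 i
      have h₂ := hpc i
      have h₃ := hlu i
      linarith

/-! ### Parameters, initialization and invariants of reachable states -/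

def chunkSize (n : ℕ) : ℕ := n.sqrt + 1

/-- The summands count the last chunk, the special cuts and the full chunks. -/
def fanout (d n : ℕ) : ℕ := 1 + 2 * d * chunkSize n + 2 * chunkSize n

def initTime (d n : ℕ) : ℕ :=
  d * (1000 * (n * (Nat.clog 2 (2 * n) + 1))) + 20 * n + 20 * chunkSize n + 200 +
    buildTime ((100 * d + 1300) * n + (80 * d + 530) * fanout d n + 130) (fanout d n) d

def visitBound (d n : ℕ) : ℕ :=
  1 + 2 * (d * (2 * (2 * (fanout d n ^ (d - 1) * (Nat.clog 2 (fanout d n) + d + 1)))))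

theorem exists_setup {d : ℕ} {B₀ : List Sides} (hd : ∀ b ∈ B₀, b.length = d) (hne : B₀ ≠ []) :
    ∃ v : WTree, Calls setupFn (encodeBoxList B₀) v.encode (initTime d B₀.length) ∧
      v.WellFormed ∧ (∀ b ∈ B₀, v.Good b ∧ v.visits b ≤ visitBound d B₀.length) ∧
      v.box.length = d ∧ ∀ f, v.integral f =
        ∑ p ∈ Fintype.piFinset fun i : Fin d => gridCenters B₀ i, f (List.ofFn p) := by
  have hn : B₀.length ≠ 0 := by simpa using hne
  obtain ⟨D, B, hsort, hD, hDl⟩ := calls_sortDims hn (SortedDims.nil (B₀ := B₀)) rfl hd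
  simp only [List.length_nil, zero_add] at hDl
  have hroot := calls_root B₀.length (k := 0) (j := chunkSize B₀.length) (by simp [chunkSize])
  have hlen := calls_len (B₀.map encodeSides)
  rw [List.length_map] at hlen
  -- The construction starts from the empty product, a single point of weight 1 in dimension 0,
  -- which no box meets partially.
  have hcell : IsPartialTree B (chunkSize B₀.length) (Nat.clog 2 (fanout d B₀.length)) 0
      (elem [] 1) := by
    have h1 : ∀ b, relBox b [] = 1 := by rintro (_ | _) <;> rfl
    refine ⟨rfl, .inr (by simp), by simp [h1], fun b _ => (h1 b).le, by simp [crossings]⟩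
  obtain ⟨v, hv, hb⟩ := exists_build (fun b hb => (hd b hb).le) rfl hn
    (Nat.lt_succ_sqrt B₀.length).le (Nat.succ_pos _) (K := fanout d B₀.length) le_rfl hD
    (by omega) hcell
  refine ⟨v, .of_wp setupBody rfl ?_, hb.wellFormed, fun b hbB => ⟨hb.good b hbB, ?_⟩, ?_, ?_⟩
  · obtain ⟨b, B', hbB⟩ := List.exists_cons_of_ne_nil hne
    have hB₀ : encodeBoxList B₀ = .cons (encodeSides b) (encodeBoxList B') := by
      rw [hbB, encodeBoxList_cons]
    have hlen' : Calls lenFn (encodeBoxList B₀) (.num B₀.length) (20 * B₀.length + 10) := hlen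
    simp only [encodeDims_nil, WTree.encode, encodeSides_nil, Nat.cast_zero] at hsort hv hroot
    rw [hB₀] at hsort hlen' ⊢
    simp [setupBody, wp]
    refine ⟨_, _, hsort, _, _, hlen', _, _, hroot, _, _, hv, ?_⟩
    simp only [Yields, true_and, initTime, hDl]
    omega
  · refine (v.visits_le b).trans ?_
    rw [visitBound]
    have : ∀ i < b.length, ∀ a, v.crossings i a ≤ 2 * (fanout d B₀.length ^ (d - 1) *
        (Nat.clog 2 (fanout d B₀.length) + d + 1)) := by
      intro i hi a
      have := hb.crossings_pending i (by rw [hDl, ← hd b hbB]; exact hi) a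
      rw [hDl] at this
      omega
    have := sumEnds_le this
    rw [hd b hbB] at this
    omega
  · rw [hb.box_eq, List.length_append, length_fullBox, hDl]
    rfl
  · intro f
    rw [hb.integral_eq]
    subst hDl
    simp only [WTree.integral, boxCenter, List.map_nil, List.append_nil, one_mul]
    exact gridSum_eq hD hne f

/-- The weight index. -/
noncomputable def weightIndex : DataStructure where
  program := indexProgram
  initFun := setupFn
  queryFun := queryFn
  updateFun := updateFn

theorem Runs.eq_of_calls {f : ℕ} {a r s : Val} {t T : ℕ} (h : Calls f a r T)
    (hs : Runs indexProgram f a s t) : s = r := by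
  obtain ⟨t', ht', -⟩ := h.runs
  exact (hs.deterministic ht').1

/-- Evaluation is deterministic, so every reachable state is the one that the symbolic execution
predicts. The invariant is that the integral over the tree is the sum over the grid with the current
weights. -/
theorem exists_tree_of_reaches {d : ℕ} {B : List (Box (Fin d))} (hB : B ≠ []) {s : Val}
    {w : (Fin d → ℝ) → ℝ} (h : Reaches weightIndex B s w) :
    ∃ v : WTree, s = v.encode ∧ v.WellFormed ∧
      (∀ b ∈ B, v.Good (boxSides b) ∧ v.visits (boxSides b) ≤ visitBound d B.length) ∧
      v.box.length = d ∧ ∀ f, v.integral f =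
        ∑ p ∈ Fintype.piFinset fun i : Fin d => gridCenters (B.map boxSides) i,
          f (List.ofFn p) * w p := by
  induction h with
  | start h =>
    obtain ⟨v, hv, hw, hg, hl, hi⟩ := exists_setup (d := d) (B₀ := B.map boxSides)
      (by simp [boxSides]) (by simpa using hB)
    rw [encodeBoxes_eq] at h
    refine ⟨v, Runs.eq_of_calls hv h, hw, fun b hb => ?_, hl, by simpa using hi⟩
    simpa using hg _ (List.mem_map_of_mem hb)
  | @update s s' w b α t hs hb hα h ih =>
    obtain ⟨v, rfl, hw, hg, hl, hi⟩ := ih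
    have hc := calls_update v (boxSides b) α (le_refl _)
    rw [encodeBox_eq] at h
    refine ⟨v.update (boxSides b) α, Runs.eq_of_calls hc h, hw.update _ _, fun b' hb' => ?_,
      by rwa [box_update], fun f => ?_⟩
    · rw [good_update, visits_update]
      exact hg b' hb'
    · rw [integral_update hw (by simp [boxSides, hl]) (hg b hb).1, hi]
      refine Finset.sum_congr rfl fun p _ => ?_
      rw [mul_assoc]
      congr 1
      unfold scaleWeights
      split_ifs with hp
      · rw [boxFun_of_mem ((inClosed_boxSides b p).2 hp)]
      · rw [boxFun_of_not_mem fun h => hp ((inClosed_boxSides b p).1 h), one_mul]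

theorem isWeightIndex {d : ℕ} (B : List (Box (Fin d))) :
    IsWeightIndex weightIndex B (initTime d B.length + 2)
      ((50 * d + 100) * visitBound d B.length + 2)
      ((100 * d + 400) * visitBound d B.length + 2) where
  init_runs := by
    -- For the empty family the state is `nil`, and no query or update can occur.
    by_cases hB : B = []
    · subst hB
      have : Calls setupFn (encodeBoxes (d := d) []) .nil (initTime d 0) :=
        .of_wp setupBody rfl (by
          simp [setupBody, wp, Yields, encodeBoxes, initTime]
          omega)
      obtain ⟨t, ht, hT⟩ := this.runs
      exact ⟨_, t, ht, hT⟩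
    · obtain ⟨v, hv, -⟩ := exists_setup (d := d) (B₀ := B.map boxSides)
        (by simp [boxSides]) (by simpa using hB)
      rw [← encodeBoxes_eq, List.length_map] at hv
      obtain ⟨t, ht, hT⟩ := hv.runs
      exact ⟨_, t, ht, hT⟩
  query_runs := by
    intro s w h b hb
    obtain ⟨v, rfl, hw, hg, hl, hi⟩ := exists_tree_of_reaches (List.ne_nil_of_mem hb) h
    obtain ⟨hgb, hvb⟩ := hg b hb
    have hlb : (boxSides b).length = v.box.length := by simp [boxSides, hl]
    have hc := calls_query v (boxSides b) (k := d) (by simp [boxSides])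
    have hq : v.query (boxSides b) = totalWeight B w b := by
      classical
      have hf : (discretization B).filter (fun p => p ∈ Box.Icc b) =
          (Fintype.piFinset fun i : Fin d => gridCenters (B.map boxSides) i).filter
            fun p => p ∈ Box.Icc b := by
        ext p
        rw [Finset.mem_filter, Finset.mem_filter]
        exact and_congr_left fun hp => mem_discretization_iff B hb hp
      have hs : totalWeight B w b = ∑ p ∈ (discretization B).filter fun p => p ∈ Box.Icc b, w p := by
        unfold totalWeight
        congr!
      rw [query_eq_integral hw hlb hgb, hi, hs, hf]
      rw [Finset.sum_filter]
      refine Finset.sum_congr rfl fun p _ => ?_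
      split_ifs with hp
      · rw [boxFun_of_mem ((inClosed_boxSides b p).2 hp), one_mul]
      · rw [boxFun_of_not_mem fun h => hp ((inClosed_boxSides b p).1 h), zero_mul]
    rw [hq, ← encodeBox_eq] at hc
    obtain ⟨t, ht, hT⟩ := hc.runs
    exact ⟨t, ht, hT.trans (by gcongr)⟩
  update_runs := by
    intro s w h b hb α hα
    obtain ⟨v, rfl, hw, hg, hl, hi⟩ := exists_tree_of_reaches (List.ne_nil_of_mem hb) h
    obtain ⟨hgb, hvb⟩ := hg b hb
    have hc := calls_update v (boxSides b) α (k := d) (by simp [boxSides])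
    rw [← encodeBox_eq] at hc
    obtain ⟨t, ht, hT⟩ := hc.runs
    exact ⟨_, t, ht, hT.trans (by gcongr)⟩

/-! ### Asymptotic bounds -/

theorem isBigO_rpow_rpow {a b : ℝ} (h : a ≤ b) :
    (fun n : ℕ => (n : ℝ) ^ a) =O[atTop] fun n : ℕ => (n : ℝ) ^ b := by
  refine IsBigO.of_bound 1 ?_
  filter_upwards [eventually_ge_atTop 1] with n hn
  have hn : (1 : ℝ) ≤ n := by exact_mod_cast hn
  rw [one_mul, Real.norm_of_nonneg (by positivity), Real.norm_of_nonneg (by positivity)]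
  exact Real.rpow_le_rpow_of_exponent_le hn h

theorem isBigO_const_rpow (k : ℝ) {b : ℝ} (h : 0 ≤ b) :
    (fun _ : ℕ => k) =O[atTop] fun n : ℕ => (n : ℝ) ^ b := by
  refine IsBigO.trans ?_ (isBigO_rpow_rpow h)
  simpa using isBigO_const_const k (one_ne_zero (α := ℝ)) (atTop : Filter ℕ)

theorem isBigO_natCast_rpow {b : ℝ} (h : 1 ≤ b) :
    (fun n : ℕ => (n : ℝ)) =O[atTop] fun n : ℕ => (n : ℝ) ^ b := by
  simpa using isBigO_rpow_rpow h

theorem isBigO_const_log (k : ℝ) :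
    (fun _ : ℕ => k) =O[atTop] fun n : ℕ => Real.log n :=
  (isLittleO_const_left.2 <| .inr <| tendsto_norm_atTop_atTop.comp <|
    Real.tendsto_log_atTop.comp tendsto_natCast_atTop_atTop).isBigO

/-- A linear bound on `g` costs only an additive constant in the logarithm. -/
theorem isBigO_clog {g : ℕ → ℕ} (c : ℕ) (hg : ∀ n, 1 ≤ n → g n ≤ c * n) :
    (fun n => (Nat.clog 2 (g n) : ℝ)) =O[atTop] fun n : ℕ => Real.log n := by
  have h : (fun n : ℕ => (Real.log c / Real.log 2 + 1) + (Real.log 2)⁻¹ * Real.log n)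
      =O[atTop] fun n : ℕ => Real.log n :=
    (isBigO_const_log _).add ((isBigO_refl _ _).const_mul_left _)
  refine IsBigO.trans (IsBigO.of_norm_eventuallyLE ?_) h
  filter_upwards [eventually_ge_atTop 1] with n hn
  rw [Real.norm_of_nonneg (Nat.cast_nonneg _)]
  have hlog2 : 0 < Real.log 2 := Real.log_pos one_lt_two
  obtain rfl | hc := Nat.eq_zero_or_pos c
  · have : g n = 0 := by simpa using hg n hn
    have hln : 0 ≤ Real.log n := Real.log_natCast_nonneg n
    rw [this]
    simp only [Nat.clog_zero_right, Nat.cast_zero, Real.log_zero, zero_div, zero_add]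
    positivity
  · have h₁ : Nat.clog 2 (g n) ≤ Nat.clog 2 (c * n) := Nat.clog_mono_right 2 (hg n hn)
    have h₂ : (Nat.clog 2 (c * n) : ℝ) < Real.logb 2 (c * n : ℕ) + 1 := by
      rw [← Real.natCeil_logb_natCast]
      refine Nat.ceil_lt_add_one (Real.logb_nonneg one_lt_two ?_)
      exact_mod_cast Nat.mul_pos hc hn
    have h₃ : Real.logb 2 (c * n : ℕ) = Real.log c / Real.log 2 + (Real.log 2)⁻¹ * Real.log n := by
      rw [Real.logb, Nat.cast_mul, Real.log_mul (by positivity) (by positivity)]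
      ring
    have h₁ : (Nat.clog 2 (g n) : ℝ) ≤ Nat.clog 2 (c * n) := by exact_mod_cast h₁
    linarith

theorem isBigO_chunkSize :
    (fun n => (chunkSize n : ℝ)) =O[atTop] fun n : ℕ => (n : ℝ) ^ (1 / 2 : ℝ) := by
  have h : (fun n => (n.sqrt : ℝ)) =O[atTop] fun n : ℕ => (n : ℝ) ^ (1 / 2 : ℝ) := by
    refine IsBigO.of_norm_le fun n => ?_
    rw [Real.norm_of_nonneg (Nat.cast_nonneg _), ← Real.sqrt_eq_rpow]
    exact Real.nat_sqrt_le_real_sqrt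
  simpa [chunkSize] using h.add (isBigO_const_rpow 1 (by norm_num))

theorem isBigO_fanout (d : ℕ) :
    (fun n => (fanout d n : ℝ)) =O[atTop] fun n : ℕ => (n : ℝ) ^ (1 / 2 : ℝ) := by
  have h := ((isBigO_const_rpow 1 (b := 1 / 2) (by norm_num)).add
    (isBigO_chunkSize.const_mul_left (2 * d))).add (isBigO_chunkSize.const_mul_left 2)
  simpa [fanout] using h

theorem fanout_le (d n : ℕ) (hn : 1 ≤ n) : fanout d n ≤ (4 * d + 5) * n := by
  have h : chunkSize n ≤ 2 * n := by
    have := Nat.sqrt_le_self n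
    unfold chunkSize
    omega
  have h₁ : 2 * d * chunkSize n ≤ 2 * d * (2 * n) := by gcongr
  have h₂ : (4 * d + 5) * n = 2 * d * (2 * n) + 4 * n + n := by ring
  unfold fanout
  omega

theorem isBigO_visitBound {d : ℕ} (hd : 2 ≤ d) :
    (fun n => (visitBound d n : ℝ)) =O[atTop]
      fun n : ℕ => (n : ℝ) ^ (((d : ℝ) - 1) / 2) * Real.log n := by
  have hd1 : (1 : ℝ) ≤ d := by exact_mod_cast (by omega : 1 ≤ d)
  have h₁ : (fun n => (fanout d n : ℝ) ^ (d - 1)) =O[atTop]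
      fun n : ℕ => (n : ℝ) ^ (((d : ℝ) - 1) / 2) := by
    refine ((isBigO_fanout d).pow (d - 1)).congr_right fun n => ?_
    rw [← Real.rpow_mul_natCast (by positivity), Nat.cast_sub (by omega)]
    congr 1
    push_cast
    ring
  have h₂ : (fun n => (Nat.clog 2 (fanout d n) : ℝ) + d + 1) =O[atTop]
      fun n : ℕ => Real.log n :=
    ((isBigO_clog _ (fanout_le d)).add (isBigO_const_log d)).add (isBigO_const_log 1)
  have h₃ : (fun _ : ℕ => (1 : ℝ)) =O[atTop]
      fun n : ℕ => (n : ℝ) ^ (((d : ℝ) - 1) / 2) * Real.log n := by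
    simpa using (isBigO_const_rpow 1 (b := ((d : ℝ) - 1) / 2) (by linarith)).mul
      (isBigO_const_log 1)
  -- The constant `8 * d` collects two visited nodes per crossing, two ends in each of `d`
  -- dimensions, and the factor 2 of `crossings_pending`.
  have h := h₃.add ((h₁.mul h₂).const_mul_left (8 * d))
  refine h.congr_left fun n => ?_
  simp only [visitBound]
  push_cast
  ring

/-- Each dimension multiplies the time by O(√n), which raises the exponent by 1/2; the additional
linear term is dominated because the new exponent is at least 1. -/
theorem isBigO_buildTime {Q K : ℕ → ℕ} (hQ : (fun n => (Q n : ℝ)) =O[atTop] fun n : ℕ => (n : ℝ))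
    (hK : (fun n => (K n : ℝ)) =O[atTop] fun n : ℕ => (n : ℝ) ^ (1 / 2 : ℝ)) (j : ℕ) :
    (fun n => (buildTime (Q n) (K n) j : ℝ)) =O[atTop]
      fun n : ℕ => (n : ℝ) ^ (((j : ℝ) + 1) / 2) := by
  induction j with
  | zero => simpa [buildTime] using isBigO_const_rpow 20 (b := 1 / 2) (by norm_num)
  | succ j ih =>
    have h₁ := hQ.trans (isBigO_natCast_rpow (b := ((j + 1 : ℕ) + 1) / 2) (by
      push_cast
      have := Nat.cast_nonneg (α := ℝ) j
      linarith))
    have h₂ : (fun n => (K n : ℝ) * buildTime (Q n) (K n) j) =O[atTop]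
        fun n : ℕ => (n : ℝ) ^ ((((j + 1 : ℕ) : ℝ) + 1) / 2) := by
      refine (hK.mul ih).congr_right fun n => ?_
      rw [← Real.rpow_add_of_nonneg (by positivity) (by positivity) (by positivity)]
      congr 1
      push_cast
      ring
    refine (h₁.add h₂).congr_left fun n => ?_
    simp [buildTime]

theorem isBigO_initTime {d : ℕ} (hd : 2 ≤ d) :
    (fun n => (initTime d n : ℝ)) =O[atTop] fun n : ℕ => (n : ℝ) ^ (((d : ℝ) + 1) / 2) := by
  have hd2 : (2 : ℝ) ≤ d := by exact_mod_cast hd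
  have hn : (fun n : ℕ => (n : ℝ)) =O[atTop] fun n : ℕ => (n : ℝ) ^ (((d : ℝ) + 1) / 2) :=
    isBigO_natCast_rpow (by linarith)
  have hc : (fun n => (chunkSize n : ℝ)) =O[atTop] fun n : ℕ => (n : ℝ) ^ (((d : ℝ) + 1) / 2) :=
    isBigO_chunkSize.trans (isBigO_rpow_rpow (by linarith))
  have hlog : (fun n : ℕ => Real.log n) =O[atTop] fun n : ℕ => (n : ℝ) ^ (1 / 2 : ℝ) :=
    ((isLittleO_log_rpow_atTop (by norm_num : (0 : ℝ) < 1 / 2)).comp_tendsto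
      tendsto_natCast_atTop_atTop).isBigO
  -- The time O(n log n) for sorting is O(n ^ (3/2)), and this is where `2 ≤ d` makes it fit under
  -- the exponent `(d + 1) / 2`.
  have hs : (fun n : ℕ => (n : ℝ) * ((Nat.clog 2 (2 * n) : ℝ) + 1)) =O[atTop]
      fun n : ℕ => (n : ℝ) ^ (((d : ℝ) + 1) / 2) := by
    have h₁ : (fun n : ℕ => (n : ℝ)) =O[atTop] fun n : ℕ => (n : ℝ) ^ (1 : ℝ) :=
      isBigO_natCast_rpow le_rfl
    have h₂ := (((isBigO_clog (g := fun n => 2 * n) 2 fun _ _ => le_rfl).trans hlog).add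
      (isBigO_const_rpow 1 (b := 1 / 2) (by norm_num)))
    refine ((h₁.mul h₂).congr_right fun n => ?_).trans
      (isBigO_rpow_rpow (a := 1 + 1 / 2) (by linarith))
    rw [← Real.rpow_add_of_nonneg (by positivity) (by norm_num) (by norm_num)]
  have hn1 : (fun n : ℕ => (n : ℝ)) =O[atTop] fun n : ℕ => (n : ℝ) := isBigO_refl _ _
  have hQ : (fun n => (((100 * d + 1300) * n + (80 * d + 530) * fanout d n + 130 : ℕ) : ℝ))
      =O[atTop] fun n : ℕ => (n : ℝ) := by
    have hf : (fun n => (fanout d n : ℝ)) =O[atTop] fun n : ℕ => (n : ℝ) := by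
      refine (isBigO_fanout d).trans ?_
      simpa using isBigO_rpow_rpow (a := 1 / 2) (b := 1) (by norm_num)
    have h1 : (fun _ : ℕ => (130 : ℝ)) =O[atTop] fun n : ℕ => (n : ℝ) := by
      simpa using isBigO_const_rpow 130 (b := 1) (by norm_num)
    refine (((hn1.const_mul_left (100 * d + 1300)).add
      (hf.const_mul_left (80 * d + 530))).add h1).congr_left fun n => ?_
    push_cast
    ring
  have h := ((((hs.const_mul_left (d * 1000)).add (hn.const_mul_left 20)).add
    (hc.const_mul_left 20)).add (isBigO_const_rpow 200 (b := ((d : ℝ) + 1) / 2)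
    (by linarith))).add (isBigO_buildTime hQ (isBigO_fanout d) d)
  refine h.congr_left fun n => ?_
  simp only [initTime]
  push_cast
  ring

theorem isBigO_operationTime {d : ℕ} (hd : 2 ≤ d) (c : ℕ) :
    (fun n => ((c * visitBound d n + 2 : ℕ) : ℝ)) =O[atTop]
      fun n : ℕ => (n : ℝ) ^ (((d : ℝ) - 1) / 2) * Real.log n := by
  have hd2 : (2 : ℝ) ≤ d := by exact_mod_cast hd
  have h : (fun _ : ℕ => (2 : ℝ)) =O[atTop]
      fun n : ℕ => (n : ℝ) ^ (((d : ℝ) - 1) / 2) * Real.log n := by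
    simpa using (isBigO_const_rpow 1 (b := ((d : ℝ) - 1) / 2) (by linarith)).mul
      (isBigO_const_log 2)
  refine (((isBigO_visitBound hd).const_mul_left c).add h).congr_left fun n => ?_
  push_cast
  ring

end CoverageKernel

theorem theorem4 (d : ℕ) (hd : 2 ≤ d) :
    ∃ (S : CoverageKernel.DataStructure) (tInit tQuery tUpdate : ℕ → ℕ),
      ((fun n : ℕ => (tInit n : ℝ)) =O[atTop] fun n : ℕ => (n : ℝ) ^ (((d : ℝ) + 1) / 2)) ∧
      ((fun n : ℕ => (tQuery n : ℝ)) =O[atTop]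
        fun n : ℕ => (n : ℝ) ^ (((d : ℝ) - 1) / 2) * Real.log n) ∧
      ((fun n : ℕ => (tUpdate n : ℝ)) =O[atTop]
        fun n : ℕ => (n : ℝ) ^ (((d : ℝ) - 1) / 2) * Real.log n) ∧
      ∀ B : List (BoxIntegral.Box (Fin d)),
        CoverageKernel.IsWeightIndex S B (tInit B.length) (tQuery B.length)
          (tUpdate B.length) := by
  refine ⟨CoverageKernel.weightIndex, fun n => CoverageKernel.initTime d n + 2,
    fun n => (50 * d + 100) * CoverageKernel.visitBound d n + 2,
    fun n => (100 * d + 400) * CoverageKernel.visitBound d n + 2, ?_,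
    CoverageKernel.isBigO_operationTime hd _, CoverageKernel.isBigO_operationTime hd _,
    CoverageKernel.isWeightIndex⟩
  have hd2 : (2 : ℝ) ≤ d := by exact_mod_cast hd
  simpa using (CoverageKernel.isBigO_initTime hd).add
    (CoverageKernel.isBigO_const_rpow 2 (b := ((d : ℝ) + 1) / 2) (by linarith))
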